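/- \textbf{Setting.} Let $d\in\mathbb N$. A \emph{ranking} of $[d]=\{1,\dots,d\}$ is a map $r:[d]\to[d]$ such that $\#\{b: r(b)<r(a)\}=r(a)-1$ for all $a\in[d]$ (ties are allowed); $\mathcal R$ is the set of all rankings. For $x\in\mathbb R^d$ let $rk(x)\in\mathcal R$ be given by $rk(x)(i)=1+\#\{j: x_j>x_i\}$. For each $r\in\mathcal R$ let $\mu^r$ be a probability distribution on $\mathbb R^d$ with finite second moments, and let $q^r_i$ be the mean of its $i$-th coordinate. A \emph{ranking-based process} with increment laws $(\mu^r)_{r\in\mathcal R}$ and initial distribution $\nu$ (a probability distribution on $\mathbb R^d$ with finite second moments) is a time-homogeneous Markov process $X_n=(X^1_n,\dots,X^d_n)$, $n\ge 0$, in $\mathbb R^d$, adapted to and Markov with respect to some filtration on a probability space, with $X_0\sim\nu$ and transition kernel $\mu(x,B)=\mu^{rk(x)}(B-x)$, where $B-x=\{y: y+x\in B\}$. Its law is written $\mathbb P_\nu$. It is a \emph{ranking-based P\'olya urn} if every $\mu^r$ is concentrated on vectors in $\{0,1\}^d$ whose coordinates sum to $1$. Its \emph{urn function} is defined on $\Delta^{d-1}=\{x\in[0,1]^d:\sum_i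 x_i=1\}$ by letting $f_i(x)=\mu^{rk(x)}(\{z: z_i=1\})=q^{rk(x)}_i$ be the probability that the next ball has color $i$ when the ranking is $rk(x)$. For $i,j\in[d]$ say that $i$ \emph{quasi-dominates} $j$ if for every $r\in\mathcal R$ with $r(i)<r(j)$ either $q^r_i>q^r_j$ or $\mu^r(z_i\ne z_j)=0$; and that $i$ \emph{dominates} $j$ if moreover for every $r\in\mathcal R$ with $r(i)=r(j)$ either $\mu^r(z_i>z_j)>0$ or $\mu^r(z_i\neq z_j)=0$. \emph{Ranking-based reinforcement} holds if for any $i,j\in[d]$ either one of them dominates the other or they quasi-dominate each other. \textbf{Proposition.} Consider a ranking-based P\'olya urn with urn function $f$, and let $$A=\{x\in\Delta^{d-1}: f(x)=x,\ x_i\ne x_j\text{ for all }i\ne j\}.$$ \begin{enumerate} \item For every $x\in A$ there is an initial distribution $\nu$ such that $\mathbb P_\nu(X_n/n\to x)>0$. If $q^r_i>0$ for all $i\in[d]$ and $r\in\mathcal R$, then $\mathbb P_\nu(X_n/n\to x)>0$ for every $x\in A$ and every initial distribution $\nu$. \item If $q^r_i>0$ for all $i\in[d]$ and $r\in\mathcal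 R$, and ranking-based reinforcement holds, then for every initial distribution $\nu$, almost surely $X_n/n$ converges and $\lim_{n\to\infty} X_n/n\in A$. \item For every initial distribution $\nu$, every $x\in A$ with $\mathbb P_\nu(\lim_{k\to\infty} X_k/k=x)>0$, every $i\in[d]$ with $0<x_i<1$, and every $y\in\mathbb R$, $$\mathbb P_\nu\left(\frac{X^i_n-n x_i}{\sqrt{n x_i(1-x_i)}}\le y\ \middle|\ \lim_{k\to\infty}\frac{X_k}{k}=x\right)\longrightarrow\Phi(y)\qquad(n\to\infty),$$ where $\Phi$ is the cumulative distribution function of the standard normal distribution. \end{enumerate} -/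

import Mathlib

open MeasureTheory ProbabilityTheory Filter Topology

namespace RankingUrn

/-- A ranking of `{1, …, d}` (here `Fin d`): a map to positions in `{1, …, d}` such that, for every
`a`, exactly `r a - 1` elements are ranked higher than (have a smaller position than) `a`.
Ties are allowed. -/
@[ext]
structure Ranking (d : ℕ) where
  pos : Fin d → ℕ
  pos_mem : ∀ a, pos a ∈ Finset.Icc 1 d
  card_add_one : ∀ a, (Finset.univ.filter fun b => pos b < pos a).card + 1 = pos a

theorem card_lt_card_iff {d : ℕ} (x : Fin d → ℝ) (a b : Fin d) :
    (Finset.univ.filter fun j => x b < x j).card < (Finset.univ.filter fun j => x a < x j).card ↔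
      x a < x b := by
  constructor
  · intro h
    by_contra! hab
    refine absurd (Finset.card_le_card ?_) (not_le.mpr h)
    intro j hj
    simp only [Finset.mem_filter, Finset.mem_univ, true_and] at hj ⊢
    exact lt_of_le_of_lt hab hj
  · intro h
    refine Finset.card_lt_card (Finset.ssubset_iff_of_subset ?_ |>.mpr ⟨b, ?_, ?_⟩)
    · intro j hj
      simp only [Finset.mem_filter, Finset.mem_univ, true_and] at hj ⊢
      exact h.trans hj
    · simpa using h
    · simp

/-- The standard competition ranking of the coordinates of a vector, in descending order:
the position of `i` is one plus the number of coordinates strictly larger than `x i`. -/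
noncomputable def rk {d : ℕ} (x : Fin d → ℝ) : Ranking d where
  pos i := (Finset.univ.filter fun j => x i < x j).card + 1
  pos_mem i := by
    have h : (Finset.univ.filter fun j => x i < x j).card < (Finset.univ : Finset (Fin d)).card :=
      Finset.card_lt_card (Finset.filter_ssubset.mpr ⟨i, Finset.mem_univ i, lt_irrefl _⟩)
    rw [Finset.card_univ, Fintype.card_fin] at h
    rw [Finset.mem_Icc]
    omega
  card_add_one i := by
    simp only [Nat.add_lt_add_iff_right, card_lt_card_iff]

/-- All coordinates have a finite second moment. -/
def HasFiniteSecondMoments {d : ℕ} (ρ : Measure (Fin d → ℝ)) : Prop :=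
  ∀ i, MemLp (fun z : Fin d → ℝ => z i) 2 ρ

/-- An admissible family of increment laws, one for each ranking. -/
structure IsIncrementFamily {d : ℕ} (μ : Ranking d → Measure (Fin d → ℝ)) : Prop where
  prob : ∀ r, IsProbabilityMeasure (μ r)
  secondMoments : ∀ r, HasFiniteSecondMoments (μ r)

/-- The transition kernel `μ(x, B) = μ^{rk x}(B - x)`, with `B - x = {y | y + x ∈ B}`. -/
noncomputable def transition {d : ℕ} (μ : Ranking d → Measure (Fin d → ℝ))
    (x : Fin d → ℝ) (B : Set (Fin d → ℝ)) : ℝ :=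
  (μ (rk x)).real {y | y + x ∈ B}

/-- `X` is, under the probability measure `P`, a time-homogeneous Markov process with respect to
the filtration `ℱ`, with initial distribution `ν` (having finite second moments) and with the
transition kernel determined by the increment laws `μ`. -/
structure IsRankingBasedProcess {d : ℕ} (μ : Ranking d → Measure (Fin d → ℝ))
    (ν : Measure (Fin d → ℝ)) {Ω : Type*} {mΩ : MeasurableSpace Ω} (P : Measure Ω)
    (ℱ : Filtration ℕ mΩ) (X : ℕ → Ω → Fin d → ℝ) : Prop where
  increments : IsIncrementFamily μ
  prob : IsProbabilityMeasure P
  adapted : ∀ n, Measurable[ℱ n] (X n)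
  initial : P.map (X 0) = ν
  initial_secondMoments : HasFiniteSecondMoments ν
  markov : ∀ (n : ℕ) (B : Set (Fin d → ℝ)), MeasurableSet B →
    P⟦X (n + 1) ⁻¹' B | ℱ n⟧ =ᵐ[P] fun ω => transition μ (X n ω) B

/-- The increment laws of a ranking-based Pólya urn: almost surely all coordinates of an increment
are `0` or `1` and they sum to `1`. (Every ranking is the ranking of some vector, so this has to
be required of the law attached to every ranking.) -/
structure IsPolyaUrn {d : ℕ} (μ : Ranking d → Measure (Fin d → ℝ)) : Prop
    extends IsIncrementFamily μ where
  zero_or_one : ∀ r, ∀ᵐ z ∂(μ r), ∀ i, z i = 0 ∨ z i = 1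
  sum_eq_one : ∀ r, ∀ᵐ z ∂(μ r), ∑ i, z i = 1

/-- `q^r_i`, the mean of the `i`-th coordinate of `μ^r`. -/
noncomputable def mean {d : ℕ} (μ : Ranking d → Measure (Fin d → ℝ)) (r : Ranking d)
    (i : Fin d) : ℝ :=
  ∫ z, z i ∂(μ r)

/-- The urn function: `f_i(x)` is the probability that the next ball is of colour `i`
when the current ranking is that of `x`. -/
noncomputable def urnFunction {d : ℕ} (μ : Ranking d → Measure (Fin d → ℝ))
    (x : Fin d → ℝ) (i : Fin d) : ℝ :=
  (μ (rk x)).real {z | z i = 1}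

/-- The fixed points, in the standard simplex, of the urn function with pairwise distinct
coordinates. -/
def distinctFixedPoints {d : ℕ} (μ : Ranking d → Measure (Fin d → ℝ)) : Set (Fin d → ℝ) :=
  {x | x ∈ stdSimplex ℝ (Fin d) ∧ urnFunction μ x = x ∧ ∀ i j, i ≠ j → x i ≠ x j}

/-- `i` quasi-dominates `j`. -/
def QuasiDominates {d : ℕ} (μ : Ranking d → Measure (Fin d → ℝ)) (i j : Fin d) : Prop :=
  ∀ r : Ranking d, r.pos i < r.pos j → mean μ r j < mean μ r i ∨ μ r {z | z i ≠ z j} = 0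

/-- `i` dominates `j`. -/
def Dominates {d : ℕ} (μ : Ranking d → Measure (Fin d → ℝ)) (i j : Fin d) : Prop :=
  QuasiDominates μ i j ∧
    ∀ r : Ranking d, r.pos i = r.pos j → 0 < μ r {z | z j < z i} ∨ μ r {z | z i ≠ z j} = 0

/-- Ranking-based reinforcement: of any two indices one dominates the other, or they
quasi-dominate each other. -/
def Reinforcement {d : ℕ} (μ : Ranking d → Measure (Fin d → ℝ)) : Prop :=
  ∀ i j : Fin d, (Dominates μ i j ∨ Dominates μ j i) ∨
    (QuasiDominates μ i j ∧ QuasiDominates μ j i)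

/-- The event `X_n / n → x`. -/
def limitEvent {d : ℕ} {Ω : Type*} (X : ℕ → Ω → Fin d → ℝ) (x : Fin d → ℝ) : Set Ω :=
  {ω | Tendsto (fun n : ℕ => (n : ℝ)⁻¹ • X n ω) atTop (𝓝 x)}

end RankingUrn

namespace RankingUrn

variable {d : ℕ}

/-! ### Rankings -/

/-! An urn only adds unit vectors, so it reduces to a process that adds colour `c` with conditional
probability `q r c`, where `r` is the current ranking (`IsDrawProcess`). While the ranking stays at
`r`, the draws behave like i.i.d. draws from `q r`. Hence, once the ranking has settled at `r`,
proportions converge to `q r`. A point `x` of `A` is exactly a vector `q r` for a tie-free `r` whose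
order is that of the entries of `q r`.

Positive probability: if `r` ranks `i` before `j` and `q r i > q r j`, the gap between the two
counts drifts upwards. The sum of `exp (-ε * gap)` over the ordered pairs is a supermartingale as
long as the order holds, and it is at least `1` as soon as some pair fails. From large gaps the
order therefore survives forever with positive probability (`measureReal_not_stay_le`). Large gaps
come either from starting at a multiple of `x` or, if all `q r i` are positive, from forcing
finitely many draws (`exists_forced`).

Almost sure convergence: under reinforcement with positive `q`, each pair contains a colour whose
drift relative to the other is positive whenever it leads. From a tie or a lead, this colour pulls
ahead forever with probability bounded below. By Lévy's zero-one law (`ae_mem_of_frequently_mem`) it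
is either eventually strictly ahead or eventually strictly behind, so the ranking settles at some
tie-free `r`. Moreover `q r` has the order of `r` (`ae_lt_of_eventually_rk_eq`). Otherwise a
positive gap with nonpositive drift would make a bounded-increment martingale bounded below, hence
convergent, and the leading colour would no longer be drawn, against its limiting proportion `q r i
> 0`.

Central limit theorem: on the limit event the ranking is eventually `rk x`. The exponential of the
centred count of one colour, divided by the power of a Bernoulli characteristic function, is a
product of factors of conditional mean one. Approximating the indicator of the event by its
conditional expectations shows that conditioning does not change the limit
(`tendsto_setIntegral_exp`), and Lévy's continuity theorem finishes. -/

theorem rk_pos_lt_iff (x : Fin d → ℝ) (i j : Fin d) :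
    (rk x).pos i < (rk x).pos j ↔ x j < x i := by
  simp only [rk, Nat.add_lt_add_iff_right, card_lt_card_iff]

theorem Ranking.ext_of_lt_iff {r s : Ranking d}
    (h : ∀ i j, r.pos i < r.pos j ↔ s.pos i < s.pos j) : r = s := by
  ext a
  rw [← r.card_add_one a, ← s.card_add_one a]
  simp only [h]

theorem rk_eq_iff (x : Fin d → ℝ) (r : Ranking d) :
    rk x = r ↔ ∀ i j, (r.pos i < r.pos j ↔ x j < x i) := by
  constructor
  · rintro rfl i j
    exact rk_pos_lt_iff x i j
  · intro h
    exact Ranking.ext_of_lt_iff fun i j => (rk_pos_lt_iff x i j).trans (h i j).symm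

theorem rk_eq_of_lt {x : Fin d → ℝ} {r : Ranking d} (hr : ∀ i j, i ≠ j → r.pos i ≠ r.pos j)
    (h : ∀ i j, r.pos i < r.pos j → x j < x i) : rk x = r := by
  rw [rk_eq_iff]
  refine fun i j => ⟨h i j, fun hx => ?_⟩
  have hij : i ≠ j := by rintro rfl; exact lt_irrefl _ hx
  exact (lt_or_gt_of_ne (hr i j hij)).resolve_right fun h' => lt_asymm hx (h j i h')

theorem rk_pos_ne {x : Fin d → ℝ} (h : ∀ i j, i ≠ j → x i ≠ x j) (i j : Fin d) (hij : i ≠ j) :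
    (rk x).pos i ≠ (rk x).pos j := by
  rcases lt_or_gt_of_ne (h i j hij) with h' | h'
  · exact ((rk_pos_lt_iff x j i).2 h').ne'
  · exact ((rk_pos_lt_iff x i j).2 h').ne

instance : Finite (Ranking d) := by
  refine Finite.of_injective
    (fun (r : Ranking d) (a : Fin d) => (⟨r.pos a, ?_⟩ : Fin (d + 1))) ?_
  · exact Nat.lt_succ_of_le (Finset.mem_Icc.1 (r.pos_mem a)).2
  · intro r s h
    ext a
    simpa using congrFun h a

instance : MeasurableSpace (Ranking d) := ⊤

instance : DiscreteMeasurableSpace (Ranking d) := ⟨fun _ => trivial⟩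

theorem measurable_rk : Measurable (rk : (Fin d → ℝ) → Ranking d) := by
  refine measurable_to_countable' fun r => ?_
  have : (rk ⁻¹' {r} : Set (Fin d → ℝ)) =
      ⋂ (i) (j), {x : Fin d → ℝ | r.pos i < r.pos j ↔ x j < x i} := by
    ext x
    simp [rk_eq_iff]
  rw [this]
  refine MeasurableSet.iInter fun i => MeasurableSet.iInter fun j => ?_
  exact (MeasurableSet.const _).iff
    (measurableSet_lt (measurable_pi_apply j) (measurable_pi_apply i))

/-! ### The transition kernel -/

/-- The transition kernel of a ranking-based process, as a kernel. -/
noncomputable def stepKernel (μ : Ranking d → Measure (Fin d → ℝ)) [∀ r, SFinite (μ r)] :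
    Kernel (Fin d → ℝ) (Fin d → ℝ) where
  toFun x := (μ (rk x)).map (· + x)
  measurable' := by
    refine Measure.measurable_of_measurable_coe _ fun B hB => ?_
    have h : Measurable fun p : Ranking d × (Fin d → ℝ) => (μ p.1) {y | y + p.2 ∈ B} := by
      -- There are only finitely many rankings, so joint measurability is checked for each fixed
      -- ranking.
      refine measurable_from_prod_countable_right fun r => ?_
      exact measurable_measure_prodMk_left (ν := μ r)
        (s := {p : (Fin d → ℝ) × (Fin d → ℝ) | p.2 + p.1 ∈ B})
        ((measurable_snd.add measurable_fst) hB)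
    have h2 := h.comp (measurable_rk.prodMk measurable_id)
    have h3 : (fun x => ((μ (rk x)).map (· + x)) B) =
        (fun p : Ranking d × (Fin d → ℝ) => (μ p.1) {y | y + p.2 ∈ B}) ∘ fun x => (rk x, id x) := by
      ext x
      rw [Measure.map_apply (by fun_prop) hB]
      rfl
    rw [h3]
    exact h2

theorem stepKernel_apply (μ : Ranking d → Measure (Fin d → ℝ)) [∀ r, SFinite (μ r)]
    (x : Fin d → ℝ) {B : Set (Fin d → ℝ)} (hB : MeasurableSet B) :
    stepKernel μ x B = μ (rk x) {y | y + x ∈ B} := by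
  change (μ (rk x)).map (· + x) B = _
  rw [Measure.map_apply (by fun_prop) hB]
  rfl

instance (μ : Ranking d → Measure (Fin d → ℝ)) [∀ r, IsProbabilityMeasure (μ r)] :
    IsMarkovKernel (stepKernel μ) where
  isProbabilityMeasure x := by
    change IsProbabilityMeasure ((μ (rk x)).map (· + x))
    exact Measure.isProbabilityMeasure_map (by fun_prop)

theorem stepKernel_real (μ : Ranking d → Measure (Fin d → ℝ)) [∀ r, SFinite (μ r)]
    (x : Fin d → ℝ) {B : Set (Fin d → ℝ)} (hB : MeasurableSet B) :
    (stepKernel μ x).real B = transition μ x B := by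
  rw [Measure.real, stepKernel_apply μ x hB]
  rfl

section Pair

variable {μ : Ranking d → Measure (Fin d → ℝ)} {ν : Measure (Fin d → ℝ)} {Ω : Type*}
  {mΩ : MeasurableSpace Ω} {P : Measure Ω} {ℱ : Filtration ℕ mΩ} {X : ℕ → Ω → Fin d → ℝ}

theorem IsRankingBasedProcess.measurable (h : IsRankingBasedProcess μ ν P ℱ X) (n : ℕ) :
    Measurable (X n) := (h.adapted n).mono (ℱ.le n) le_rfl

/-- The Markov property is given for fixed target sets `B`. Checking it on rectangles upgrades it to
a disintegration of the joint law, so that it also applies to events such as `X (n + 1) = X n +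
e_c`, whose target set depends on `X n`. -/
theorem IsRankingBasedProcess.map_pair (h : IsRankingBasedProcess μ ν P ℱ X)
    [∀ r, IsProbabilityMeasure (μ r)] (n : ℕ)
    {A : Set Ω} (hA : MeasurableSet[ℱ n] A) :
    (P.restrict A).map (fun ω => (X n ω, X (n + 1) ω)) =
      ((P.restrict A).map (X n)) ⊗ₘ (stepKernel μ) := by
  have := h.prob
  have hn := h.measurable n
  have hn1 := h.measurable (n + 1)
  refine Measure.ext_prod fun {S T} hS hT => ?_
  have hA' : MeasurableSet[ℱ n] (A ∩ X n ⁻¹' S) := hA.inter ((h.adapted n) hS)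
  have hint : ∫ ω in A ∩ X n ⁻¹' S, transition μ (X n ω) T ∂P =
      P.real (X (n + 1) ⁻¹' T ∩ (A ∩ X n ⁻¹' S)) := by
    rw [← setIntegral_congr_ae (g := fun ω => transition μ (X n ω) T) (ℱ.le n _ hA')
      ((h.markov n T hT).mono fun ω hω _ => hω),
      setIntegral_condExp (ℱ.le n) ((integrable_const _).indicator (hn1 hT)) hA',
      integral_indicator (hn1 hT), Measure.restrict_restrict (hn1 hT)]
    simp
  rw [Measure.compProd_apply_prod hS hT, Measure.map_apply (hn.prodMk hn1) (hS.prod hT),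
    setLIntegral_map hS (Kernel.measurable_coe _ hT) hn, Measure.restrict_restrict (hn hS),
    Measure.restrict_apply ((hn.prodMk hn1) (hS.prod hT))]
  have h1 : (fun ω => (X n ω, X (n + 1) ω)) ⁻¹' S ×ˢ T ∩ A =
      X (n + 1) ⁻¹' T ∩ (A ∩ X n ⁻¹' S) := by
    ext ω
    simp only [Set.mem_inter_iff, Set.mem_preimage, Set.mem_prod]
    tauto
  have h2 : ∀ ω, stepKernel μ (X n ω) T = ENNReal.ofReal (transition μ (X n ω) T) := by
    intro ω
    rw [← stepKernel_real μ _ hT, ofReal_measureReal]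
  have hm : Measurable fun ω => transition μ (X n ω) T := by
    simp_rw [← stepKernel_real μ _ hT]
    exact ((Kernel.measurable_coe (stepKernel μ) hT).comp hn).ennreal_toReal
  rw [h1, Set.inter_comm (X n ⁻¹' S) A]
  simp_rw [h2]
  rw [← ofReal_integral_eq_lintegral_ofReal, hint, ofReal_measureReal]
  · refine Integrable.of_bound hm.aestronglyMeasurable 1 (ae_of_all _ fun ω => ?_)
    rw [Real.norm_eq_abs, ← stepKernel_real μ _ hT, abs_of_nonneg measureReal_nonneg]
    exact measureReal_le_one
  · exact ae_of_all _ fun ω => measureReal_nonneg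

end Pair

/-! ### Drawing balls -/

/-- The event that the `n`-th ball drawn has colour `c`. -/
def draw {Ω : Type*} (X : ℕ → Ω → Fin d → ℝ) (n : ℕ) (c : Fin d) : Set Ω :=
  {ω | X (n + 1) ω = X n ω + Pi.single c 1}

theorem draw_disjoint {Ω : Type*} {X : ℕ → Ω → Fin d → ℝ} {n : ℕ} {c c' : Fin d} {ω : Ω}
    (h : ω ∈ draw X n c) (h' : ω ∈ draw X n c') : c = c' := by
  have : (Pi.single c 1 : Fin d → ℝ) = Pi.single c' 1 := by
    have h1 : X (n + 1) ω = _ := h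
    have h2 : X (n + 1) ω = _ := h'
    exact add_left_cancel (h1.symm.trans h2)
  by_contra hne
  have h3 := congrFun this c
  simp [hne] at h3

/-- A process that, at each time, adds one ball, of colour `c` with conditional probability
`q r c` where `r` is the current ranking. -/
structure IsDrawProcess (q : Ranking d → Fin d → ℝ) {Ω : Type*} {mΩ : MeasurableSpace Ω}
    (P : Measure Ω) (ℱ : Filtration ℕ mΩ) (X : ℕ → Ω → Fin d → ℝ) : Prop where
  prob : IsProbabilityMeasure P
  adapted : ∀ n, Measurable[ℱ n] (X n)
  nonneg : ∀ r c, 0 ≤ q r c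
  sum_eq : ∀ r, ∑ c, q r c = 1
  exists_draw : ∀ᵐ ω ∂P, ∀ n, ∃ c, ω ∈ draw X n c
  condExp_draw : ∀ n c, P⟦draw X n c | ℱ n⟧ =ᵐ[P] fun ω => q (rk (X n ω)) c

section Urn

variable {μ : Ranking d → Measure (Fin d → ℝ)}

theorem IsPolyaUrn.ae_eq_single (h : IsPolyaUrn μ) (r : Ranking d) :
    ∀ᵐ z ∂(μ r), ∃ c, z = Pi.single c 1 := by
  filter_upwards [h.zero_or_one r, h.sum_eq_one r] with z h01 hs
  have : ∃ c, z c = 1 := by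
    by_contra! hne
    have : ∑ i, z i = 0 := Finset.sum_eq_zero fun i _ => (h01 i).resolve_right (hne i)
    linarith
  obtain ⟨c, hc⟩ := this
  refine ⟨c, ?_⟩
  have h0 : ∑ i ∈ Finset.univ.erase c, z i = 0 := by
    have := Finset.add_sum_erase Finset.univ z (Finset.mem_univ c)
    linarith
  rw [Finset.sum_eq_zero_iff_of_nonneg
    (fun i _ => by rcases h01 i with h | h <;> simp [h])] at h0
  ext i
  by_cases hi : i = c
  · subst hi; simp [hc]
  · simp [hi, h0 i (by simp [hi])]

theorem IsPolyaUrn.mean_eq (h : IsPolyaUrn μ) (r : Ranking d) (c : Fin d) :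
    mean μ r c = (μ r).real {z | z c = 1} := by
  have := h.prob r
  have hm : MeasurableSet {z : Fin d → ℝ | z c = 1} :=
    measurableSet_eq_fun (measurable_pi_apply c) measurable_const
  rw [mean, ← integral_indicator_one hm]
  refine integral_congr_ae ?_
  filter_upwards [h.zero_or_one r] with z hz
  rcases hz c with h | h <;> simp [Set.indicator, h]

theorem IsPolyaUrn.urnFunction_eq (h : IsPolyaUrn μ) (x : Fin d → ℝ) :
    urnFunction μ x = mean μ (rk x) := by
  ext c
  rw [h.mean_eq]
  rfl

theorem IsPolyaUrn.mean_eq_single (h : IsPolyaUrn μ) (r : Ranking d) (c : Fin d) :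
    mean μ r c = (μ r).real {Pi.single c 1} := by
  rw [h.mean_eq]
  refine measureReal_congr ?_
  filter_upwards [h.ae_eq_single r] with z hz
  obtain ⟨c', rfl⟩ := hz
  refine propext ?_
  change (Pi.single c' 1 : Fin d → ℝ) c = 1 ↔ (Pi.single c' 1 : Fin d → ℝ) = Pi.single c 1
  by_cases hc : c' = c
  · subst hc; simp
  · have h1 : (Pi.single c' 1 : Fin d → ℝ) c = 0 := by simp [Ne.symm hc]
    refine iff_of_false (by simp [h1]) fun h2 => ?_
    rw [h2] at h1
    simp at h1

theorem IsPolyaUrn.mean_nonneg (h : IsPolyaUrn μ) (r : Ranking d) (c : Fin d) :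
    0 ≤ mean μ r c := by
  rw [h.mean_eq]; exact measureReal_nonneg

theorem IsPolyaUrn.sum_mean (h : IsPolyaUrn μ) (r : Ranking d) : ∑ c, mean μ r c = 1 := by
  have := h.prob r
  unfold mean
  rw [← integral_finsetSum]
  · rw [integral_congr_ae (h.sum_eq_one r)]
    simp
  · intro i _
    refine Integrable.of_bound (measurable_pi_apply i).aestronglyMeasurable 1 ?_
    filter_upwards [h.zero_or_one r] with z hz
    rcases hz i with h | h <;> simp [h]

theorem IsRankingBasedProcess.isDrawProcess (hμ : IsPolyaUrn μ) {ν : Measure (Fin d → ℝ)}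
    {Ω : Type*} {mΩ : MeasurableSpace Ω} {P : Measure Ω} {ℱ : Filtration ℕ mΩ}
    {X : ℕ → Ω → Fin d → ℝ} (h : IsRankingBasedProcess μ ν P ℱ X) :
    IsDrawProcess (mean μ) P ℱ X where
  prob := h.prob
  adapted := h.adapted
  nonneg := hμ.mean_nonneg
  sum_eq := hμ.sum_mean
  exists_draw := by
    have := h.prob
    have := hμ.prob
    rw [ae_all_iff]
    intro n
    have hn := h.measurable n
    have hn1 := h.measurable (n + 1)
    have hm : MeasurableSet {p : (Fin d → ℝ) × (Fin d → ℝ) | ∃ c, p.2 = p.1 + Pi.single c 1} := by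
      simp only [Set.ofPred_exists]
      exact MeasurableSet.iUnion fun c => measurableSet_eq_fun (by fun_prop) (by fun_prop)
    have h1 : ∀ᵐ p ∂(P.map fun ω => (X n ω, X (n + 1) ω)), ∃ c, p.2 = p.1 + Pi.single c 1 := by
      have h2 := h.map_pair n MeasurableSet.univ
      rw [Measure.restrict_univ] at h2
      rw [h2]
      refine Measure.ae_compProd_of_ae_ae hm (ae_of_all _ fun x => ?_)
      change ∀ᵐ y ∂((μ (rk x)).map (· + x)), _
      have hm' : MeasurableSet {y : Fin d → ℝ | ∃ c, y = x + Pi.single c 1} := by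
        simp only [Set.ofPred_exists]
        exact MeasurableSet.iUnion fun c => measurableSet_eq_fun (by fun_prop) (by fun_prop)
      rw [ae_map_iff (by fun_prop) hm']
      filter_upwards [hμ.ae_eq_single (rk x)] with z hz
      obtain ⟨c, rfl⟩ := hz
      exact ⟨c, add_comm _ _⟩
    exact ae_of_ae_map (hn.prodMk hn1).aemeasurable h1
  condExp_draw := by
    have := h.prob
    have := hμ.prob
    intro n c
    have hn := h.measurable n
    have hn1 := h.measurable (n + 1)
    have hd : MeasurableSet (draw X n c) :=
      measurableSet_eq_fun hn1 (hn.add measurable_const)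
    have hmq : Measurable fun x => mean μ (rk x) c :=
      (Measurable.of_discrete (f := fun r => mean μ r c)).comp measurable_rk
    have hq1 : ∀ r, mean μ r c ≤ 1 := fun r => by
      rw [hμ.mean_eq]; exact measureReal_le_one
    have hint : Integrable (fun ω => mean μ (rk (X n ω)) c) P :=
      Integrable.of_bound (hmq.comp hn).aestronglyMeasurable 1 (ae_of_all _ fun ω => by
        rw [Real.norm_eq_abs, abs_of_nonneg (hμ.mean_nonneg _ _)]; exact hq1 _)
    -- It suffices to integrate over past events `A`. There `map_pair` applies to the event `p.2 =
    -- p.1 + e_c`, whose fibre over `x` has kernel mass `mean μ (rk x) c`.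
    refine (ae_eq_condExp_of_forall_setIntegral_eq (ℱ.le n)
      ((integrable_const _).indicator hd) (fun _ _ _ => hint.integrableOn) ?_
      ((hmq.comp (h.adapted n)).stronglyMeasurable.aestronglyMeasurable)).symm
    intro A hA _
    have hm : MeasurableSet {p : (Fin d → ℝ) × (Fin d → ℝ) | p.2 = p.1 + Pi.single c 1} :=
      measurableSet_eq_fun (by fun_prop) (by fun_prop)
    have h1 := congrArg (fun ρ => ρ {p : (Fin d → ℝ) × (Fin d → ℝ) | p.2 = p.1 + Pi.single c 1})
      (h.map_pair n hA)
    have h3 : ∀ x : Fin d → ℝ,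
        stepKernel μ x (Prod.mk x ⁻¹' {p | p.2 = p.1 + Pi.single c 1}) =
          ENNReal.ofReal (mean μ (rk x) c) := by
      intro x
      rw [stepKernel_apply μ x (measurable_prodMk_left hm), hμ.mean_eq_single, ofReal_measureReal]
      congr 1
      ext y
      change y + x = x + _ ↔ y = _
      rw [add_comm, add_right_inj]
    simp only [Measure.compProd_apply hm, h3] at h1
    rw [Measure.map_apply (hn.prodMk hn1) hm, lintegral_map (by fun_prop) hn,
      ← ofReal_integral_eq_lintegral_ofReal hint.integrableOn
        (ae_of_all _ fun ω => hμ.mean_nonneg _ _)] at h1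
    have h4 := congrArg ENNReal.toReal h1
    rw [ENNReal.toReal_ofReal (integral_nonneg fun ω => hμ.mean_nonneg _ _)] at h4
    rw [← h4, integral_indicator hd, ← Measure.real]
    simp only [integral_const, smul_eq_mul, mul_one]
    rw [measureReal_restrict_apply_univ, Measure.real, Measure.real]
    rfl

end Urn

/-! ### Expectations over one draw. -/

namespace IsDrawProcess

variable {q : Ranking d → Fin d → ℝ} {Ω : Type*} {mΩ : MeasurableSpace Ω}
    {P : Measure Ω} {ℱ : Filtration ℕ mΩ} {X : ℕ → Ω → Fin d → ℝ}

theorem le_one (h : IsDrawProcess q P ℱ X) (r : Ranking d) (c : Fin d) : q r c ≤ 1 := by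
  rw [← h.sum_eq r]
  exact Finset.single_le_sum (fun i _ => h.nonneg r i) (Finset.mem_univ c)

theorem measurable (h : IsDrawProcess q P ℱ X) (n : ℕ) : Measurable (X n) :=
  (h.adapted n).mono (ℱ.le n) le_rfl

theorem measurable_rk (h : IsDrawProcess q P ℱ X) (n : ℕ) :
    Measurable[ℱ n] fun ω => rk (X n ω) := RankingUrn.measurable_rk.comp (h.adapted n)

theorem measurable_prob (h : IsDrawProcess q P ℱ X) (n : ℕ) (c : Fin d) :
    Measurable[ℱ n] fun ω => q (rk (X n ω)) c :=
  (Measurable.of_discrete (f := fun r => q r c)).comp (h.measurable_rk n)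

theorem measurableSet_draw (h : IsDrawProcess q P ℱ X) (n : ℕ) (c : Fin d) :
    MeasurableSet[ℱ (n + 1)] (draw X n c) :=
  measurableSet_eq_fun (h.adapted (n + 1))
    (((h.adapted n).mono (ℱ.mono n.le_succ) le_rfl).add measurable_const)

theorem measurableSet_draw' (h : IsDrawProcess q P ℱ X) (n : ℕ) (c : Fin d) :
    MeasurableSet (draw X n c) := ℱ.le _ _ (h.measurableSet_draw n c)

variable {E : Type*} [NormedAddCommGroup E] [NormedSpace ℝ E] [CompleteSpace E]

theorem integral_indicator_draw (h : IsDrawProcess q P ℱ X) (n : ℕ) (c : Fin d) {Y : Ω → E}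
    (hY : StronglyMeasurable[ℱ n] Y) {C : ℝ} (hC : ∀ ω, ‖Y ω‖ ≤ C) :
    ∫ ω, (draw X n c).indicator Y ω ∂P = ∫ ω, q (rk (X n ω)) c • Y ω ∂P := by
  have := h.prob
  have h1 := condExp_stronglyMeasurable_bilin_of_bound
    (ContinuousLinearMap.lsmul ℝ ℝ : ℝ →L[ℝ] E →L[ℝ] E).flip (ℱ.le n) hY
    ((integrable_const (1 : ℝ)).indicator (μ := P) (h.measurableSet_draw' n c)) C (ae_of_all _ hC)
  have h2 := (integral_condExp (ℱ.le n)).symm.trans (integral_congr_ae h1)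
  refine Eq.trans (integral_congr_ae (ae_of_all _ fun ω => ?_)) (h2.trans (integral_congr_ae ?_))
  · by_cases hω : ω ∈ draw X n c <;> simp [hω]
  · filter_upwards [h.condExp_draw n c] with ω hω
    simp [hω]

/-- One-step identity: the expectation of a function of the past and of the ball drawn. -/
theorem integral_step (h : IsDrawProcess q P ℱ X) (n : ℕ) {Y : Fin d → Ω → E} {Z : Ω → E}
    (hY : ∀ c, StronglyMeasurable[ℱ n] (Y c)) {C : ℝ} (hC : ∀ c ω, ‖Y c ω‖ ≤ C)
    (hZ : ∀ c, ∀ ω ∈ draw X n c, Z ω = Y c ω) :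
    ∫ ω, Z ω ∂P = ∫ ω, ∑ c, q (rk (X n ω)) c • Y c ω ∂P := by
  have := h.prob
  have hint : ∀ c, Integrable (Y c) P := fun c =>
    Integrable.of_bound ((hY c).mono (ℱ.le n)).aestronglyMeasurable C (ae_of_all _ (hC c))
  have hZ' : Z =ᵐ[P] fun ω => ∑ c, (draw X n c).indicator (Y c) ω := by
    filter_upwards [h.exists_draw] with ω hω
    obtain ⟨c, hc⟩ := hω n
    rw [Finset.sum_eq_single c, Set.indicator_of_mem hc, hZ c ω hc]
    · intro c' _ hne
      exact Set.indicator_of_notMem (fun h' => hne (draw_disjoint h' hc)) _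
    · simp
  rw [integral_congr_ae hZ', integral_finsetSum _
    fun c _ => (hint c).indicator (h.measurableSet_draw' n c), integral_finsetSum]
  · exact Finset.sum_congr rfl fun c _ => h.integral_indicator_draw n c (hY c) (hC c)
  · intro c _
    refine (hint c).bdd_smul 1
      ((h.measurable_prob n c).mono (ℱ.le n) le_rfl).aestronglyMeasurable
      (ae_of_all _ fun ω => ?_)
    rw [Real.norm_eq_abs, abs_of_nonneg (h.nonneg _ _)]
    exact h.le_one _ _

end IsDrawProcess

/-- Uses `exp u ≤ 1 + u + u ^ 2` for `|u| ≤ 1`. This one estimate serves both the order-keeping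
supermartingale and the concentration bound for the centred counts. -/
theorem sum_mul_exp_le {ι : Type*} (s : Finset ι) {w x : ι → ℝ} (hw : ∀ c, 0 ≤ w c)
    (hw1 : ∑ c ∈ s, w c = 1) {θ : ℝ} (hθ : |θ| ≤ 1) (hx : ∀ c, |x c| ≤ 1) :
    ∑ c ∈ s, w c * Real.exp (θ * x c) ≤ 1 + θ * ∑ c ∈ s, w c * x c + θ ^ 2 := by
  calc ∑ c ∈ s, w c * Real.exp (θ * x c)
      ≤ ∑ c ∈ s, w c * (1 + θ * x c + θ ^ 2) := by
        refine Finset.sum_le_sum fun c _ => mul_le_mul_of_nonneg_left ?_ (hw c)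
        have h1 : |θ * x c| ≤ 1 := by
          rw [abs_mul]; exact mul_le_one₀ hθ (abs_nonneg _) (hx c)
        have h2 := (abs_le.1 (Real.abs_exp_sub_one_sub_id_le h1)).2
        have h3 : (θ * x c) ^ 2 ≤ θ ^ 2 := by
          rw [mul_pow]
          exact mul_le_of_le_one_right (sq_nonneg _) ((sq_le_one_iff_abs_le_one _).2 (hx c))
        linarith
    _ = (∑ c ∈ s, w c) + θ * ∑ c ∈ s, w c * x c + θ ^ 2 * ∑ c ∈ s, w c := by
        simp only [Finset.mul_sum, ← Finset.sum_add_distrib]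
        exact Finset.sum_congr rfl fun c _ => by ring
    _ = _ := by rw [hw1, mul_one]

theorem sum_mul_single (w : Fin d → ℝ) (i : Fin d) :
    ∑ c, w c * (Pi.single c 1 : Fin d → ℝ) i = w i := by
  simp [Pi.single_apply]

theorem abs_single_sub_single_le (c i j : Fin d) :
    |(Pi.single c 1 : Fin d → ℝ) i - (Pi.single c 1 : Fin d → ℝ) j| ≤ 1 := by
  simp only [Pi.single_apply]
  split_ifs <;> simp

namespace IsDrawProcess

variable {q : Ranking d → Fin d → ℝ} {Ω : Type*} {mΩ : MeasurableSpace Ω}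
    {P : Measure Ω} {ℱ : Filtration ℕ mΩ} {X : ℕ → Ω → Fin d → ℝ}

/-! ### Keeping a drifting order forever -/

/-- The lower bound `ε` on the drift is itself a small enough exponent: the gain `ε * (q r i - q r
j) ≥ ε ^ 2` pays for the quadratic error. -/
theorem sum_mul_exp_single_le_one (h : IsDrawProcess q P ℱ X) {r : Ranking d} {i j : Fin d}
    {ε : ℝ} (hε : 0 < ε) (hij : ε ≤ q r i - q r j) :
    ∑ c, q r c * Real.exp (-ε * ((Pi.single c 1 : Fin d → ℝ) i - (Pi.single c 1 : Fin d → ℝ) j))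
      ≤ 1 := by
  have hε1 : ε ≤ 1 := by linarith [h.le_one r i, h.nonneg r j]
  refine (sum_mul_exp_le Finset.univ (h.nonneg r) (h.sum_eq r) (θ := -ε)
    (by rw [abs_neg, abs_of_pos hε]; exact hε1)
    fun c => abs_single_sub_single_le c i j).trans ?_
  simp only [mul_sub, Finset.sum_sub_distrib, sum_mul_single]
  nlinarith

/-- A maximal inequality: `U`, the sum of `exp (-ε * gap)` over `S`, is a supermartingale until the
order first breaks, is at least `1` at that moment, and is at most `S.card * exp (-ε * L)` on `G` at
time `m`. -/
theorem measureReal_not_stay_le (h : IsDrawProcess q P ℱ X) {S : Finset (Fin d × Fin d)} {ε : ℝ}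
    (hε : 0 < ε) (hS : ∀ r : Ranking d, (∀ p ∈ S, r.pos p.1 < r.pos p.2) →
      ∀ p ∈ S, ε ≤ q r p.1 - q r p.2) {m : ℕ} {G : Set Ω} (hG : MeasurableSet[ℱ m] G) {L : ℝ}
    (hL : 0 < L) (hGL : ∀ ω ∈ G, ∀ p ∈ S, L ≤ X m ω p.1 - X m ω p.2) :
    P.real (G \ {ω | ∀ k, ∀ p ∈ S, X (m + k) ω p.2 < X (m + k) ω p.1}) ≤
      S.card * Real.exp (-ε * L) * P.real G := by
  have := h.prob
  let R : ℕ → Set Ω := fun n => {ω | ∀ p ∈ S, X n ω p.2 < X n ω p.1}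
  have hR : ∀ n, MeasurableSet[ℱ n] (R n) := by
    intro n
    have : R n = ⋂ p ∈ S, {ω | X n ω p.2 < X n ω p.1} := by ext; simp [R]
    rw [this]
    exact S.measurableSet_biInter fun p _ => measurableSet_lt
      ((measurable_pi_apply _).comp (h.adapted n)) ((measurable_pi_apply _).comp (h.adapted n))
  -- `A k` is the part of `G` on which the order of all pairs in `S` has held from time `m` through
  -- time `m + k`.
  obtain ⟨A, hA0, hAs⟩ : ∃ A : ℕ → Set Ω, A 0 = G ∧ ∀ k, A (k + 1) = A k ∩ R (m + k + 1) :=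
    ⟨Nat.rec G fun k B => B ∩ R (m + k + 1), rfl, fun _ => rfl⟩
  have hAsub : ∀ k, A (k + 1) ⊆ A k := fun k => by rw [hAs]; exact Set.inter_subset_left
  have hAm : ∀ k, MeasurableSet[ℱ (m + k)] (A k) := by
    intro k
    induction k with
    | zero => rw [hA0]; exact hG
    | succ k ih => rw [hAs]; exact (ℱ.mono (Nat.le_succ _) _ ih).inter (hR _)
  have hAm' : ∀ k, MeasurableSet (A k) := fun k => ℱ.le _ _ (hAm k)
  have hAR : ∀ k, A k ⊆ R (m + k) := by
    intro k
    cases k with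
    | zero =>
      rw [hA0]
      exact fun ω hω p hp => by have := hGL ω hω p hp; simp only [add_zero]; linarith
    | succ k => rw [hAs]; exact Set.inter_subset_right
  let U : ℕ → Ω → ℝ := fun n ω => ∑ p ∈ S, Real.exp (-ε * (X n ω p.1 - X n ω p.2))
  have hUm : ∀ n, Measurable[ℱ n] (U n) := by
    intro n
    refine Finset.measurable_fun_sum _ fun p _ => Real.measurable_exp.comp ?_
    exact (((measurable_pi_apply _).comp (h.adapted n)).sub
      ((measurable_pi_apply _).comp (h.adapted n))).const_mul _
  have hU0 : ∀ n ω, 0 ≤ U n ω := fun n ω => Finset.sum_nonneg fun p _ => (Real.exp_pos _).le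
  have hUR : ∀ n, ∀ ω ∈ R n, U n ω ≤ S.card := by
    intro n ω hω
    refine (Finset.sum_le_card_nsmul S _ 1 fun p hp => ?_).trans (by simp)
    rw [Real.exp_le_one_iff]
    have := hω p hp
    nlinarith
  have hUR' : ∀ n, ∀ ω ∉ R n, 1 ≤ U n ω := by
    intro n ω hω
    simp only [R, Set.mem_ofPred_eq, not_forall, not_lt] at hω
    obtain ⟨p, hp, hle⟩ := hω
    refine le_trans ?_ (Finset.single_le_sum (fun p _ => (Real.exp_pos _).le) hp)
    rw [Real.one_le_exp_iff]
    nlinarith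
  have hstep : ∀ k, IntegrableOn (U (m + k + 1)) (A k) P ∧
      ∫ ω in A k, U (m + k + 1) ω ∂P ≤ ∫ ω in A k, U (m + k) ω ∂P := by
    intro k
    let Y : Fin d → Ω → ℝ := fun c => (A k).indicator fun ω =>
      ∑ p ∈ S, Real.exp (-ε * (X (m + k) ω p.1 - X (m + k) ω p.2)) * Real.exp (-ε *
        ((Pi.single c 1 : Fin d → ℝ) p.1 - (Pi.single c 1 : Fin d → ℝ) p.2))
    have hYm : ∀ c, StronglyMeasurable[ℱ (m + k)] (Y c) := by
      intro c
      refine (Measurable.indicator ?_ (hAm k)).stronglyMeasurable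
      refine Finset.measurable_fun_sum _ fun p _ => (Real.measurable_exp.comp ?_).mul_const _
      exact (((measurable_pi_apply _).comp (h.adapted _)).sub
        ((measurable_pi_apply _).comp (h.adapted _))).const_mul _
    have hYb : ∀ c ω, ‖Y c ω‖ ≤ S.card * Real.exp ε := by
      intro c ω
      by_cases hω : ω ∈ A k
      · simp only [Y, Set.indicator_of_mem hω]
        rw [Real.norm_eq_abs, abs_of_nonneg (Finset.sum_nonneg fun p _ => by positivity)]
        refine (Finset.sum_le_card_nsmul S _ (Real.exp ε) fun p hp => ?_).trans (by simp)
        rw [← Real.exp_add, Real.exp_le_exp]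
        have h1 := hAR k hω p hp
        have h2 := (abs_le.1 (abs_single_sub_single_le c p.1 p.2)).1
        nlinarith
      · simp only [Y, Set.indicator_of_notMem hω, norm_zero]
        positivity
    have hZ : ∀ c, ∀ ω ∈ draw X (m + k) c, (A k).indicator (U (m + k + 1)) ω = Y c ω := by
      intro c ω hω
      by_cases hA : ω ∈ A k
      · simp only [Y, Set.indicator_of_mem hA, U]
        refine Finset.sum_congr rfl fun p _ => ?_
        have h1 : X (m + k + 1) ω = X (m + k) ω + Pi.single c 1 := hω
        rw [h1, ← Real.exp_add]
        congr 1
        simp only [Pi.add_apply]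
        ring
      · simp only [Y, Set.indicator_of_notMem hA]
    have hint : Integrable ((A k).indicator (U (m + k + 1))) P := by
      refine Integrable.of_bound (((hUm _).mono (ℱ.le _) le_rfl).indicator
        (hAm' k)).aestronglyMeasurable (S.card * Real.exp ε) ?_
      filter_upwards [h.exists_draw] with ω hω
      obtain ⟨c, hc⟩ := hω (m + k)
      rw [hZ c ω hc]
      exact hYb c ω
    refine ⟨(integrable_indicator_iff (hAm' k)).1 hint, ?_⟩
    rw [← integral_indicator (hAm' k), ← integral_indicator (hAm' k),
      h.integral_step (m + k) hYm hYb hZ]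
    refine integral_mono_of_nonneg (ae_of_all _ fun ω => ?_) ?_ (ae_of_all _ fun ω => ?_)
    · refine Finset.sum_nonneg fun c _ => mul_nonneg (h.nonneg _ _) ?_
      exact Set.indicator_nonneg (fun ω _ => Finset.sum_nonneg fun p _ => by positivity) _
    · refine Integrable.of_bound (((hUm _).mono (ℱ.le _) le_rfl).indicator
        (hAm' k)).aestronglyMeasurable S.card (ae_of_all _ fun ω => ?_)
      by_cases hω : ω ∈ A k
      · rw [Set.indicator_of_mem hω, Real.norm_eq_abs, abs_of_nonneg (hU0 _ _)]
        exact hUR _ _ (hAR k hω)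
      · rw [Set.indicator_of_notMem hω, norm_zero]
        positivity
    · by_cases hω : ω ∈ A k
      · simp only [Y, Set.indicator_of_mem hω, smul_eq_mul, Finset.mul_sum, U]
        rw [Finset.sum_comm]
        refine Finset.sum_le_sum fun p hp => ?_
        have h1 : ∀ c, q (rk (X (m + k) ω)) c *
            (Real.exp (-ε * (X (m + k) ω p.1 - X (m + k) ω p.2)) * Real.exp (-ε *
              ((Pi.single c 1 : Fin d → ℝ) p.1 - (Pi.single c 1 : Fin d → ℝ) p.2))) =
            Real.exp (-ε * (X (m + k) ω p.1 - X (m + k) ω p.2)) *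
              (q (rk (X (m + k) ω)) c * Real.exp (-ε *
              ((Pi.single c 1 : Fin d → ℝ) p.1 - (Pi.single c 1 : Fin d → ℝ) p.2))) :=
          fun c => by ring
        simp only [h1, ← Finset.mul_sum]
        refine mul_le_of_le_one_right (Real.exp_pos _).le (h.sum_mul_exp_single_le_one hε ?_)
        exact hS _ (fun p hp => (rk_pos_lt_iff _ _ _).2 (hAR k hω p hp)) p hp
      · simp [Y, Set.indicator_of_notMem hω]
  -- Optional stopping by hand: the mass of `U` on the surviving paths plus the probability already
  -- lost never exceeds the initial mass, since each newly lost path carries `U ≥ 1`.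
  have hT : ∀ k, ∫ ω in A k, U (m + k) ω ∂P + P.real (G \ A k) ≤ ∫ ω in G, U m ω ∂P := by
    intro k
    induction k with
    | zero => simp [hA0]
    | succ k ih =>
      obtain ⟨hi, hle⟩ := hstep k
      have hsub := hAsub k
      have h1 := setIntegral_sdiff (hAm' (k + 1)) hi hsub
      have h2 : P.real (A k \ A (k + 1)) ≤ ∫ ω in A k \ A (k + 1), U (m + k + 1) ω ∂P := by
        have := setIntegral_mono_on (f := fun _ => (1 : ℝ)) (g := U (m + k + 1)) (μ := P)
          (s := A k \ A (k + 1)) (integrable_const _).integrableOn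
          (hi.mono_set Set.sdiff_subset) ((hAm' k).diff (hAm' (k + 1)))
          (fun ω hω => hUR' _ ω fun hR => hω.2 (by rw [hAs]; exact ⟨hω.1, hR⟩))
        simpa using this
      have h3 : P.real (G \ A (k + 1)) ≤ P.real (G \ A k) + P.real (A k \ A (k + 1)) := by
        refine (measureReal_mono ?_).trans (measureReal_union_le _ _)
        intro ω hω
        by_cases hk : ω ∈ A k
        · exact Or.inr ⟨hk, hω.2⟩
        · exact Or.inl ⟨hω.1, hk⟩
      rw [← add_assoc]
      linarith
  have hUG : ∫ ω in G, U m ω ∂P ≤ S.card * Real.exp (-ε * L) * P.real G := by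
    have hG' := ℱ.le _ _ hG
    have hb : ∀ ω ∈ G, U m ω ≤ S.card * Real.exp (-ε * L) := fun ω hω => by
      refine (Finset.sum_le_card_nsmul S _ (Real.exp (-ε * L)) fun p hp => ?_).trans (by simp)
      rw [Real.exp_le_exp]
      have := hGL ω hω p hp
      nlinarith
    have := setIntegral_mono_on (f := U m) (g := fun _ => S.card * Real.exp (-ε * L)) (μ := P)
      (s := G) ?_ (integrable_const _).integrableOn hG' hb
    · simpa [mul_comm] using this
    · refine Measure.integrableOn_of_bounded (M := S.card * Real.exp (-ε * L))
        (measure_ne_top _ _) ((hUm m).mono (ℱ.le _) le_rfl).aestronglyMeasurable ?_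
      filter_upwards [ae_restrict_mem hG'] with ω hω
      rw [Real.norm_eq_abs, abs_of_nonneg (hU0 _ _)]
      exact hb ω hω
  have hmono : Monotone fun k => G \ A k := by
    refine monotone_nat_of_le_succ fun k => ?_
    exact Set.sdiff_subset_sdiff_right (hAsub k)
  have hsub : G \ {ω | ∀ k, ∀ p ∈ S, X (m + k) ω p.2 < X (m + k) ω p.1} ⊆ ⋃ k, G \ A k := by
    rintro ω ⟨hω, hne⟩
    rw [← Set.sdiff_iInter]
    refine ⟨hω, fun hall => hne fun k => hAR k (Set.mem_iInter.1 hall k)⟩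
  have hlim := (ENNReal.tendsto_toReal (measure_ne_top P _)).comp
    (tendsto_measure_iUnion_atTop hmono (μ := P))
  refine (measureReal_mono hsub).trans (le_of_tendsto' hlim fun k => ?_)
  refine le_trans ?_ ((hT k).trans hUG)
  have : 0 ≤ ∫ ω in A k, U (m + k) ω ∂P := integral_nonneg fun ω => hU0 _ _
  change P.real (G \ A k) ≤ _
  linarith

/-! ### Forcing a sequence of draws -/

theorem measureReal_inter_draw (h : IsDrawProcess q P ℱ X) {n : ℕ} {G : Set Ω}
    (hG : MeasurableSet[ℱ n] G) (c : Fin d) :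
    P.real (G ∩ draw X n c) = ∫ ω in G, q (rk (X n ω)) c ∂P := by
  have := h.prob
  rw [← setIntegral_congr_ae (ℱ.le n _ hG) ((h.condExp_draw n c).mono fun ω hω _ => hω),
    setIntegral_condExp (ℱ.le n) ((integrable_const _).indicator (h.measurableSet_draw' n c)) hG,
    integral_indicator (h.measurableSet_draw' n c),
    Measure.restrict_restrict (h.measurableSet_draw' n c), Set.inter_comm]
  simp

theorem integrable_prob (h : IsDrawProcess q P ℱ X) (n : ℕ) (c : Fin d) :
    Integrable (fun ω => q (rk (X n ω)) c) P := by
  have := h.prob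
  refine Integrable.of_bound ((h.measurable_prob n c).mono (ℱ.le n) le_rfl).aestronglyMeasurable 1
    (ae_of_all _ fun ω => ?_)
  rw [Real.norm_eq_abs, abs_of_nonneg (h.nonneg _ _)]
  exact h.le_one _ _

/-- Drawing the colours of `s` one after another costs at least a factor `δ` per draw, whatever
rankings occur on the way. -/
theorem exists_forced (h : IsDrawProcess q P ℱ X) {δ : ℝ} (hδ : 0 ≤ δ) (s : Multiset (Fin d)) :
    ∀ (_ : ∀ c ∈ s, ∀ r, δ ≤ q r c) (m : ℕ) {G : Set Ω} (_ : MeasurableSet[ℱ m] G),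
      ∃ G' ⊆ G, MeasurableSet[ℱ (m + s.card)] G' ∧ δ ^ s.card * P.real G ≤ P.real G' ∧
        ∀ ω ∈ G', ∀ i, X (m + s.card) ω i = X m ω i + s.count i := by
  have := h.prob
  induction s using Multiset.induction_on with
  | empty => exact fun _ m G hG => ⟨G, subset_rfl, hG, by simp, by simp⟩
  | cons a s ih =>
    intro hs m G hG
    have hG1 : MeasurableSet[ℱ (m + 1)] (G ∩ draw X m a) :=
      (ℱ.mono m.le_succ _ hG).inter (h.measurableSet_draw m a)
    obtain ⟨G', hsub, hm, hP, hX⟩ := ih (fun c hc => hs c (Multiset.mem_cons_of_mem hc)) (m + 1) hG1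
    have hcard : m + (a ::ₘ s).card = m + 1 + s.card := by rw [Multiset.card_cons]; omega
    refine ⟨G', hsub.trans Set.inter_subset_left, by rwa [hcard], ?_, ?_⟩
    · refine le_trans ?_ hP
      rw [Multiset.card_cons, pow_succ, mul_assoc]
      refine mul_le_mul_of_nonneg_left ?_ (pow_nonneg hδ _)
      rw [h.measureReal_inter_draw hG]
      have := setIntegral_mono_on (f := fun _ => δ) (g := fun ω => q (rk (X m ω)) a) (μ := P)
        (s := G) (integrable_const _).integrableOn (h.integrable_prob m a).integrableOn
        (ℱ.le _ _ hG) (fun ω _ => hs a (Multiset.mem_cons_self a s) _)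
      simpa [mul_comm] using this
    · intro ω hω i
      have h1 : X (m + 1) ω = X m ω + Pi.single a 1 := (hsub hω).2
      rw [hcard, hX ω hω i, h1, Multiset.count_cons, Pi.add_apply, Pi.single_apply]
      push_cast
      ring

/-! ### The law of large numbers -/

/-- The number of balls of colour `c` drawn before time `n`, centred by the conditional means. -/
noncomputable def centredCount {Ω : Type*} (q : Ranking d → Fin d → ℝ) (X : ℕ → Ω → Fin d → ℝ)
    (c : Fin d) (n : ℕ) (ω : Ω) : ℝ :=
  ∑ k ∈ Finset.range n, ((draw X k c).indicator 1 ω - q (rk (X k ω)) c)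

theorem measurable_centredCount (h : IsDrawProcess q P ℱ X) (c : Fin d) (n : ℕ) :
    Measurable[ℱ n] (centredCount q X c n) := by
  refine Finset.measurable_fun_sum _ fun k hk => ?_
  have hk' := Finset.mem_range.1 hk
  exact ((measurable_const.indicator (h.measurableSet_draw k c)).mono (ℱ.mono hk') le_rfl).sub
    ((h.measurable_prob k c).mono (ℱ.mono hk'.le) le_rfl)

theorem abs_indicator_sub_le (h : IsDrawProcess q P ℱ X) (c : Fin d) (n : ℕ) (ω : Ω) :
    |(draw X n c).indicator 1 ω - q (rk (X n ω)) c| ≤ 1 := by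
  have h0 := h.nonneg (rk (X n ω)) c
  have h1 := h.le_one (rk (X n ω)) c
  by_cases hω : ω ∈ draw X n c
  · rw [Set.indicator_of_mem hω, Pi.one_apply, abs_le]; constructor <;> linarith
  · rw [Set.indicator_of_notMem hω, abs_le]; constructor <;> linarith

theorem abs_centredCount_le (h : IsDrawProcess q P ℱ X) (c : Fin d) (n : ℕ) (ω : Ω) :
    |centredCount q X c n ω| ≤ n := by
  refine (Finset.abs_sum_le_sum_abs _ _).trans
    ((Finset.sum_le_card_nsmul _ _ 1 fun k _ => h.abs_indicator_sub_le c k ω).trans (by simp))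

theorem integrable_exp_centredCount (h : IsDrawProcess q P ℱ X) (c : Fin d) (n : ℕ) (θ : ℝ) :
    Integrable (fun ω => Real.exp (θ * centredCount q X c n ω)) P := by
  have := h.prob
  refine Integrable.of_bound (Real.measurable_exp.comp (((h.measurable_centredCount c n).mono
    (ℱ.le n) le_rfl).const_mul θ)).aestronglyMeasurable (Real.exp (|θ| * n)) (ae_of_all _ fun ω => ?_)
  rw [Real.norm_eq_abs, abs_of_pos (Real.exp_pos _), Real.exp_le_exp]
  refine (le_abs_self _).trans ?_
  rw [abs_mul]
  exact mul_le_mul_of_nonneg_left (h.abs_centredCount_le c n ω) (abs_nonneg _)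

/-- Given the past, each increment is centred and bounded by `1`, so it multiplies the exponential
moment by at most `1 + θ ^ 2 ≤ exp (θ ^ 2)`. -/
theorem integral_exp_centredCount_le (h : IsDrawProcess q P ℱ X) (c : Fin d) {θ : ℝ}
    (hθ : |θ| ≤ 1) (n : ℕ) :
    ∫ ω, Real.exp (θ * centredCount q X c n ω) ∂P ≤ Real.exp (θ ^ 2 * n) := by
  have := h.prob
  induction n with
  | zero => simp [centredCount]
  | succ n ih =>
    let x : Ω → Fin d → ℝ := fun ω c' => (Pi.single c' 1 : Fin d → ℝ) c - q (rk (X n ω)) c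
    have hx : ∀ ω c', |x ω c'| ≤ 1 := by
      intro ω c'
      have h0 := h.nonneg (rk (X n ω)) c
      have h1 := h.le_one (rk (X n ω)) c
      simp only [x, Pi.single_apply]
      split_ifs <;> rw [abs_le] <;> constructor <;> linarith
    let Y : Fin d → Ω → ℝ := fun c' ω =>
      Real.exp (θ * centredCount q X c n ω) * Real.exp (θ * x ω c')
    have hYm : ∀ c', StronglyMeasurable[ℱ n] (Y c') := fun c' =>
      ((Real.measurable_exp.comp ((h.measurable_centredCount c n).const_mul θ)).mul
        (Real.measurable_exp.comp (((h.measurable_prob n c).const_sub _).const_mul θ)))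
          |>.stronglyMeasurable
    have hYb : ∀ c' ω, ‖Y c' ω‖ ≤ Real.exp (n + 1) := by
      intro c' ω
      rw [Real.norm_eq_abs, abs_of_pos (by positivity)]
      simp only [Y]
      rw [← Real.exp_add, Real.exp_le_exp]
      have h1 : |θ * centredCount q X c n ω| ≤ n := by
        rw [abs_mul]
        exact (mul_le_of_le_one_left (abs_nonneg _) hθ).trans (h.abs_centredCount_le c n ω)
      have h2 : |θ * x ω c'| ≤ 1 := by
        rw [abs_mul]
        exact (mul_le_of_le_one_left (abs_nonneg _) hθ).trans (hx ω c')
      linarith [(abs_le.1 h1).2, (abs_le.1 h2).2]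
    have hZ : ∀ c', ∀ ω ∈ draw X n c', Real.exp (θ * centredCount q X c (n + 1) ω) = Y c' ω := by
      intro c' ω hω
      simp only [Y]
      rw [← Real.exp_add, ← mul_add, centredCount, Finset.sum_range_succ, ← centredCount]
      congr 4
      by_cases hc : c = c'
      · subst hc
        simp [hω]
      · rw [Set.indicator_of_notMem (fun hω' => hc (draw_disjoint hω' hω)),
          Pi.single_eq_of_ne hc]
    rw [h.integral_step n hYm hYb hZ]
    calc ∫ ω, ∑ c', q (rk (X n ω)) c' • Y c' ω ∂P
        ≤ ∫ ω, Real.exp (θ * centredCount q X c n ω) * Real.exp (θ ^ 2) ∂P := by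
          refine integral_mono_of_nonneg (ae_of_all _ fun ω => ?_)
            ((h.integrable_exp_centredCount c n θ).mul_const _) (ae_of_all _ fun ω => ?_)
          · exact Finset.sum_nonneg fun c' _ => mul_nonneg (h.nonneg _ _) (by positivity)
          · have h1 : ∀ c', q (rk (X n ω)) c' • Y c' ω = Real.exp (θ * centredCount q X c n ω) *
                (q (rk (X n ω)) c' * Real.exp (θ * x ω c')) := fun c' => by
              simp only [Y, smul_eq_mul]; ring
            simp only [h1, ← Finset.mul_sum]
            refine mul_le_mul_of_nonneg_left ?_ (Real.exp_pos _).le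
            refine (sum_mul_exp_le Finset.univ (h.nonneg _) (h.sum_eq _) hθ (hx ω)).trans ?_
            have h2 : ∑ c', q (rk (X n ω)) c' * x ω c' = 0 := by
              simp only [x, mul_sub, Finset.sum_sub_distrib, sum_mul_single, ← Finset.sum_mul,
                h.sum_eq, one_mul, sub_self]
            rw [h2]
            linarith [Real.add_one_le_exp (θ ^ 2)]
      _ = (∫ ω, Real.exp (θ * centredCount q X c n ω) ∂P) * Real.exp (θ ^ 2) :=
          integral_mul_const _ _
      _ ≤ Real.exp (θ ^ 2 * n) * Real.exp (θ ^ 2) :=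
          mul_le_mul_of_nonneg_right ih (Real.exp_pos _).le
      _ = Real.exp (θ ^ 2 * (n + 1 : ℕ)) := by
          rw [← Real.exp_add]
          congr 1
          push_cast
          ring

theorem measureReal_abs_centredCount_ge_le (h : IsDrawProcess q P ℱ X) (c : Fin d) {ε : ℝ}
    (hε : 0 < ε) (hε1 : ε ≤ 1) (n : ℕ) :
    P.real {ω | ε * n ≤ |centredCount q X c n ω|} ≤ 2 * Real.exp (n * -(ε ^ 2 / 4)) := by
  have := h.prob
  -- `|θ| = ε / 2` minimises the Chernoff exponent `θ ^ 2 * n - |θ| * ε * n`, giving `-(ε ^ 2 / 4) *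
  -- n`.
  have key : ∀ θ : ℝ, |θ| = ε / 2 →
      P.real {ω | ε / 2 * (ε * n) ≤ θ * centredCount q X c n ω} ≤ Real.exp (n * -(ε ^ 2 / 4)) := by
    intro θ hθ
    have h1 := measure_ge_le_exp_mul_mgf (X := fun ω => θ * centredCount q X c n ω) (μ := P)
      (t := 1) (ε / 2 * (ε * n)) zero_le_one (by
        simpa using h.integrable_exp_centredCount c n θ)
    have h2 : mgf (fun ω => θ * centredCount q X c n ω) P 1 ≤ Real.exp (θ ^ 2 * n) := by
      simpa [mgf] using h.integral_exp_centredCount_le c (θ := θ) (by linarith) n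
    refine h1.trans ((mul_le_mul_of_nonneg_left h2 (Real.exp_pos _).le).trans ?_)
    rw [← Real.exp_add, Real.exp_le_exp, ← sq_abs θ, hθ]
    apply le_of_eq
    ring
  have h1 := key (ε / 2) (abs_of_pos (by positivity))
  have h2 := key (-(ε / 2)) (by rw [abs_neg]; exact abs_of_pos (by positivity))
  refine (measureReal_mono (s₂ := {ω | ε / 2 * (ε * n) ≤ ε / 2 * centredCount q X c n ω} ∪
    {ω | ε / 2 * (ε * n) ≤ -(ε / 2) * centredCount q X c n ω}) ?_).trans
    ((measureReal_union_le _ _).trans (by linarith))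
  intro ω hω
  rcases le_abs.1 (show ε * n ≤ |centredCount q X c n ω| from hω) with h' | h'
  · exact Or.inl (mul_le_mul_of_nonneg_left h' (by positivity))
  · refine Or.inr ?_
    have := mul_le_mul_of_nonneg_left h' (show 0 ≤ ε / 2 by positivity)
    change ε / 2 * (ε * n) ≤ -(ε / 2) * centredCount q X c n ω
    linarith

/-- The exponential tails are summable, so Borel–Cantelli applies along the thresholds `1 / (N +
1)`. -/
theorem ae_tendsto_centredCount_div (h : IsDrawProcess q P ℱ X) :
    ∀ᵐ ω ∂P, ∀ c, Tendsto (fun n : ℕ => (n : ℝ)⁻¹ * centredCount q X c n ω) atTop (𝓝 0) := by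
  have := h.prob
  have key : ∀ c, ∀ N : ℕ, ∀ᵐ ω ∂P, ∀ᶠ n : ℕ in atTop,
      ω ∉ {ω | (1 / (N + 1) : ℝ) * n ≤ |centredCount q X c n ω|} := by
    intro c N
    have hN : (0 : ℝ) < 1 / (N + 1) := by positivity
    refine ae_eventually_notMem ?_
    have hs : Summable fun n : ℕ => 2 * Real.exp (n * -((1 / (N + 1) : ℝ) ^ 2 / 4)) :=
      (Real.summable_exp_nat_mul_iff.2 (neg_neg_of_pos (by positivity))).mul_left 2
    refine ne_top_of_le_ne_top hs.tsum_ofReal_ne_top (ENNReal.tsum_le_tsum fun n => ?_)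
    rw [← ofReal_measureReal]
    exact ENNReal.ofReal_le_ofReal (h.measureReal_abs_centredCount_ge_le c hN
      (by rw [div_le_one (by positivity)]; linarith [(Nat.cast_nonneg N : (0 : ℝ) ≤ N)]) n)
  have key' : ∀ᵐ ω ∂P, ∀ c, ∀ N : ℕ, ∀ᶠ n : ℕ in atTop,
      ω ∉ {ω | (1 / (N + 1) : ℝ) * n ≤ |centredCount q X c n ω|} := by
    rw [ae_all_iff]; intro c; rw [ae_all_iff]; exact key c
  filter_upwards [key'] with ω hω c
  rw [Metric.tendsto_nhds]
  intro ε hε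
  obtain ⟨N, hN⟩ := exists_nat_one_div_lt hε
  filter_upwards [hω c N, eventually_gt_atTop 0] with n hn hn0
  have hn0' : (0 : ℝ) < n := by exact_mod_cast hn0
  rw [dist_zero_right, Real.norm_eq_abs, abs_mul, abs_of_pos (by positivity), inv_mul_lt_iff₀ hn0']
  have : |centredCount q X c n ω| < (1 / (N + 1) : ℝ) * n := not_le.1 hn
  nlinarith

theorem ae_eq_add_sum_indicator_draw (h : IsDrawProcess q P ℱ X) :
    ∀ᵐ ω ∂P, ∀ n i, X n ω i = X 0 ω i + ∑ k ∈ Finset.range n, (draw X k i).indicator 1 ω := by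
  filter_upwards [h.exists_draw] with ω hω n i
  induction n with
  | zero => simp
  | succ n ih =>
    obtain ⟨c, hc⟩ := hω n
    have h1 : X (n + 1) ω = X n ω + Pi.single c 1 := hc
    rw [h1, Finset.sum_range_succ, Pi.add_apply, ih, add_assoc]
    congr 2
    by_cases hi : i = c
    · subst hi; simp [hc]
    · rw [Set.indicator_of_notMem (fun h' => hi (draw_disjoint h' hc)), Pi.single_eq_of_ne hi]

/-- Once the ranking has settled, the proportions converge to the corresponding means. -/
theorem ae_mem_limitEvent_of_eventually_rk_eq (h : IsDrawProcess q P ℱ X) :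
    ∀ᵐ ω ∂P, ∀ r, (∀ᶠ n in atTop, rk (X n ω) = r) → ω ∈ limitEvent X (q r) := by
  filter_upwards [h.ae_tendsto_centredCount_div, h.ae_eq_add_sum_indicator_draw] with ω h1 h2 r hr
  change Tendsto _ _ _
  rw [tendsto_pi_nhds]
  intro i
  have h3 : Tendsto (fun n : ℕ => (n : ℝ)⁻¹ * ∑ k ∈ Finset.range n, q (rk (X k ω)) i) atTop
      (𝓝 (q r i)) := by
    refine Tendsto.cesaro (u := fun k => q (rk (X k ω)) i) ?_
    exact tendsto_const_nhds.congr' (hr.mono fun n hn => by simp only [hn])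
  have h4 : Tendsto (fun n : ℕ => (n : ℝ)⁻¹ * X 0 ω i) atTop (𝓝 0) := by
    simpa using tendsto_inv_atTop_nhds_zero_nat.mul_const (X 0 ω i)
  have h5 := (h4.add (h1 i)).add h3
  simp only [zero_add] at h5
  refine h5.congr fun n => ?_
  rw [Pi.smul_apply, smul_eq_mul, h2 n i, centredCount, Finset.sum_sub_distrib]
  ring

end IsDrawProcess

/-! ### Limits of positive probability. -/

theorem exists_pos_forall_le {ι : Type*} [Finite ι] {f : ι → ℝ} (hf : ∀ i, 0 < f i) :
    ∃ ε > 0, ∀ i, ε ≤ f i := by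
  rcases isEmpty_or_nonempty ι with hι | hι
  · exact ⟨1, one_pos, fun i => (hι.false i).elim⟩
  · obtain ⟨i₀, h⟩ := Finite.exists_min f
    exact ⟨f i₀, hf i₀, h⟩

theorem natCast_mul_exp_lt_one (n : ℕ) : (n : ℝ) * Real.exp (-(n + 1 : ℝ)) < 1 := by
  rw [Real.exp_neg, ← div_eq_mul_inv, div_lt_one (Real.exp_pos _)]
  linarith [Real.add_one_le_exp (n + 1 : ℝ)]

/-- The pairs `(i, j)` such that `i` is ranked strictly before `j`. -/
def orderedPairs (r : Ranking d) : Finset (Fin d × Fin d) :=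
  Finset.univ.filter fun p => r.pos p.1 < r.pos p.2

namespace IsDrawProcess

variable {q : Ranking d → Fin d → ℝ} {Ω : Type*} {mΩ : MeasurableSpace Ω}
    {P : Measure Ω} {ℱ : Filtration ℕ mΩ} {X : ℕ → Ω → Fin d → ℝ}

/-- With initial gaps `(S.card + 1) / ε` the failure bound becomes `S.card * exp (-(S.card + 1))`,
which is less than `1` by `natCast_mul_exp_lt_one`. -/
theorem mul_measureReal_le_measureReal_inter_stay (h : IsDrawProcess q P ℱ X)
    {S : Finset (Fin d × Fin d)} {ε : ℝ}
    (hε : 0 < ε) (hS : ∀ r : Ranking d, (∀ p ∈ S, r.pos p.1 < r.pos p.2) →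
      ∀ p ∈ S, ε ≤ q r p.1 - q r p.2) {m : ℕ} {G : Set Ω} (hG : MeasurableSet[ℱ m] G)
    (hGL : ∀ ω ∈ G, ∀ p ∈ S, (S.card + 1) / ε ≤ X m ω p.1 - X m ω p.2) :
    (1 - S.card * Real.exp (-(S.card + 1 : ℝ))) * P.real G ≤
      P.real (G ∩ {ω | ∀ k, ∀ p ∈ S, X (m + k) ω p.2 < X (m + k) ω p.1}) := by
  have := h.prob
  have h1 := h.measureReal_not_stay_le hε hS hG (by positivity) hGL
  have h2 : -ε * ((S.card + 1) / ε) = -(S.card + 1 : ℝ) := by field_simp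
  rw [h2] at h1
  have h3 := measureReal_union_le (μ := P)
    (G ∩ {ω | ∀ k, ∀ p ∈ S, X (m + k) ω p.2 < X (m + k) ω p.1})
    (G \ {ω | ∀ k, ∀ p ∈ S, X (m + k) ω p.2 < X (m + k) ω p.1})
  rw [Set.inter_union_sdiff] at h3
  linarith

/-- As `r` has no ties, keeping all its ordered pairs means keeping the ranking equal to `r`. The
drift condition is thus needed at `r` only, and the law of large numbers identifies the limit. -/
theorem measure_limitEvent_pos (h : IsDrawProcess q P ℱ X) {r : Ranking d}
    (hr : ∀ i j, i ≠ j → r.pos i ≠ r.pos j) {ε : ℝ} (hε : 0 < ε)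
    (hq : ∀ i j, r.pos i < r.pos j → ε ≤ q r i - q r j) {m : ℕ} {G : Set Ω}
    (hG : MeasurableSet[ℱ m] G) (hGpos : 0 < P.real G)
    (hgap : ∀ ω ∈ G, ∀ i j, r.pos i < r.pos j →
      ((orderedPairs r).card + 1) / ε ≤ X m ω i - X m ω j) :
    0 < P (limitEvent X (q r)) := by
  have := h.prob
  have hrk : ∀ x : Fin d → ℝ, (∀ p ∈ orderedPairs r, x p.2 < x p.1) → rk x = r := by
    intro x hx
    exact rk_eq_of_lt hr fun i j hij => hx (i, j) (by simpa [orderedPairs] using hij)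
  have hS : ∀ s : Ranking d, (∀ p ∈ orderedPairs r, s.pos p.1 < s.pos p.2) →
      ∀ p ∈ orderedPairs r, ε ≤ q s p.1 - q s p.2 := by
    intro s hs p hp
    have hsr : s = r := by
      refine Ranking.ext_of_lt_iff fun i j => ⟨fun hij => ?_, fun hij =>
        hs (i, j) (by simpa [orderedPairs] using hij)⟩
      have hne : i ≠ j := by rintro rfl; exact lt_irrefl _ hij
      refine (lt_or_gt_of_ne (hr i j hne)).resolve_right fun h' => ?_
      exact lt_asymm hij (hs (j, i) (by simpa [orderedPairs] using h'))
    subst hsr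
    exact hq _ _ (by simpa [orderedPairs] using hp)
  have h1 := h.mul_measureReal_le_measureReal_inter_stay hε hS hG
    (fun ω hω p hp => hgap ω hω _ _ (by simpa [orderedPairs] using hp))
  have h2 : 0 < P.real (G ∩ {ω | ∀ k, ∀ p ∈ orderedPairs r, X (m + k) ω p.2 < X (m + k) ω p.1}) :=
    lt_of_lt_of_le (mul_pos (sub_pos.2 (natCast_mul_exp_lt_one _)) hGpos) h1
  refine lt_of_lt_of_le (ENNReal.toReal_pos_iff.1 h2).1 (measure_mono_ae ?_)
  filter_upwards [h.ae_mem_limitEvent_of_eventually_rk_eq] with ω hω hmem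
  refine hω r ?_
  filter_upwards [eventually_ge_atTop m] with n hn
  obtain ⟨k, rfl⟩ := Nat.exists_eq_add_of_le hn
  exact hrk _ (hmem.2 k)

theorem measure_limitEvent_pos_of_pos (h : IsDrawProcess q P ℱ X) (hpos : ∀ r c, 0 < q r c)
    {r : Ranking d} (hr : ∀ i j, i ≠ j → r.pos i ≠ r.pos j) {ε : ℝ} (hε : 0 < ε)
    (hq : ∀ i j, r.pos i < r.pos j → ε ≤ q r i - q r j) : 0 < P (limitEvent X (q r)) := by
  have := h.prob
  obtain ⟨δ, hδ, hδq⟩ := exists_pos_forall_le (f := fun p : Ranking d × Fin d => q p.1 p.2)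
    fun p => hpos _ _
  -- The initial state is bounded by some `R` with positive probability; forcing starts from that
  -- event.
  obtain ⟨R, hR⟩ : ∃ R : ℕ, P {ω | ∀ i, |X 0 ω i| ≤ R} ≠ 0 := by
    by_contra! hne
    have h1 := measure_iUnion_null hne
    have h2 : ⋃ R : ℕ, {ω | ∀ i, |X 0 ω i| ≤ R} = Set.univ := by
      refine Set.eq_univ_of_forall fun ω => Set.mem_iUnion.2 ?_
      obtain ⟨R, hR⟩ := exists_nat_ge (∑ i, |X 0 ω i|)
      exact ⟨R, fun i => (Finset.single_le_sum (f := fun i => |X 0 ω i|)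
        (fun i _ => abs_nonneg _) (Finset.mem_univ i)).trans hR⟩
    rw [h2, measure_univ] at h1
    exact one_ne_zero h1
  have hGm : MeasurableSet[ℱ 0] {ω | ∀ i, |X 0 ω i| ≤ R} := by
    rw [Set.ofPred_forall]
    refine MeasurableSet.iInter fun i => ?_
    exact measurableSet_le (continuous_abs.measurable.comp
      ((measurable_pi_apply i).comp (h.adapted 0))) measurable_const
  have hG0 : 0 < P.real {ω | ∀ i, |X 0 ω i| ≤ R} :=
    ENNReal.toReal_pos_iff.2 ⟨pos_iff_ne_zero.2 hR, measure_lt_top _ _⟩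
  obtain ⟨N, hN⟩ := exists_nat_ge (2 * R + ((orderedPairs r).card + 1) / ε)
  -- Each step up in position gives at least `N` more balls. `N` covers the largest possible initial
  -- deficit `2 * R` and the gap required for staying.
  let s : Multiset (Fin d) := ∑ c, (N * (d - r.pos c)) • {c}
  have hs : ∀ i, s.count i = N * (d - r.pos i) := by
    intro i
    simp only [s, Multiset.count_sum', Multiset.count_nsmul, Multiset.count_singleton]
    simp
  obtain ⟨G', hsub, hm, hP, hX⟩ := h.exists_forced hδ.le s (fun c _ r => hδq (r, c)) 0 hGm
  refine h.measure_limitEvent_pos hr hε hq hm (lt_of_lt_of_le (by positivity) hP) ?_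
  intro ω hω i j hij
  rw [hX ω hω i, hX ω hω j, hs, hs]
  have hi := hsub hω i
  have hj := hsub hω j
  rw [abs_le] at hi hj
  have h1 : (N * (d - r.pos j) + N : ℝ) ≤ N * (d - r.pos i) := by
    have : ((r.pos i : ℝ) + 1) ≤ r.pos j := by exact_mod_cast hij
    nlinarith [(Nat.cast_nonneg N : (0 : ℝ) ≤ N)]
  push_cast [Nat.cast_sub (Finset.mem_Icc.1 (r.pos_mem i)).2,
    Nat.cast_sub (Finset.mem_Icc.1 (r.pos_mem j)).2]
  linarith

end IsDrawProcess

/-! ### Almost sure convergence -/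

/-- If, given the past, `E` has probability at least `η` whenever the past lies in `B n`, then
`E` occurs almost surely when `B n` occurs infinitely often. -/
theorem ae_mem_of_frequently_mem {Ω : Type*} {mΩ : MeasurableSpace Ω} {P : Measure Ω}
    [IsFiniteMeasure P] {ℱ : Filtration ℕ mΩ} {E : Set Ω}
    (hE : MeasurableSet[⨆ n, ℱ n] E) {B : ℕ → Set Ω} (hB : ∀ n, MeasurableSet[ℱ n] (B n))
    {η : ℝ} (hη : 0 < η) (h : ∀ n, ∀ A ⊆ B n, MeasurableSet[ℱ n] A →
      η * P.real A ≤ P.real (A ∩ E)) :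
    ∀ᵐ ω ∂P, (∃ᶠ n in atTop, ω ∈ B n) → ω ∈ E := by
  have hE' : MeasurableSet E := (iSup_le fun n => ℱ.le n) _ hE
  have hint : Integrable (E.indicator (1 : Ω → ℝ)) P := (integrable_const 1).indicator hE'
  -- Lévy's upward theorem: the conditional probabilities of `E` converge to its indicator.
  have hlim := hint.tendsto_ae_condExp (ℱ := ℱ)
    ((stronglyMeasurable_one (α := Ω) (β := ℝ)).indicator hE)
  have hbd : ∀ᵐ ω ∂P, ∀ n, ω ∈ B n → η ≤ (P[E.indicator (1 : Ω → ℝ) | ℱ n]) ω := by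
    rw [ae_all_iff]
    intro n
    have hA : MeasurableSet[ℱ n] (B n ∩ {ω | (P[E.indicator (1 : Ω → ℝ) | ℱ n]) ω < η}) :=
      (hB n).inter (measurableSet_lt stronglyMeasurable_condExp.measurable measurable_const)
    -- On this exceptional part of `B n` the conditional probability is below `η`; the hypothesis
    -- applied to `A` itself forces it to be null.
    set A := B n ∩ {ω | (P[E.indicator (1 : Ω → ℝ) | ℱ n]) ω < η} with hAdef
    have hA' := ℱ.le n _ hA
    have h1 := h n A Set.inter_subset_left hA
    have h2 : ∫ ω in A, (P[E.indicator (1 : Ω → ℝ) | ℱ n]) ω ∂P = P.real (A ∩ E) := by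
      rw [setIntegral_condExp (ℱ.le n) hint hA, integral_indicator_one hE',
        measureReal_restrict_apply hE', Set.inter_comm]
    have h3 : ∫ ω in A, (η - (P[E.indicator (1 : Ω → ℝ) | ℱ n]) ω) ∂P ≤ 0 := by
      rw [integral_sub (integrable_const _) integrable_condExp.integrableOn, h2]
      simp only [integral_const, measureReal_restrict_apply_univ, smul_eq_mul]
      linarith
    have h4 : P A = 0 := by
      by_contra hne
      refine not_lt.2 h3 ?_
      rw [setIntegral_pos_iff_support_of_nonneg_ae]
      · refine lt_of_lt_of_le (pos_iff_ne_zero.2 hne) (measure_mono fun ω hω => ⟨?_, hω⟩)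
        exact (sub_pos.2 hω.2).ne'
      · filter_upwards [ae_restrict_mem hA'] with ω hω
        exact (sub_pos.2 hω.2).le
      · exact (integrable_const _).sub integrable_condExp.integrableOn
    filter_upwards [measure_eq_zero_iff_ae_notMem.1 h4] with ω hω hmem
    exact not_lt.1 fun hlt => hω ⟨hmem, hlt⟩
  filter_upwards [hlim, hbd] with ω hω hb hfreq
  by_contra hne
  rw [Set.indicator_of_notMem hne] at hω
  exact absurd (ge_of_tendsto_of_frequently hω (hfreq.mono hb)) (not_le.2 hη)

namespace IsDrawProcess

variable {q : Ranking d → Fin d → ℝ} {Ω : Type*} {mΩ : MeasurableSpace Ω}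
    {P : Measure Ω} {ℱ : Filtration ℕ mΩ} {X : ℕ → Ω → Fin d → ℝ}

theorem measurableSet_eventually_lt (h : IsDrawProcess q P ℱ X) (i j : Fin d) :
    MeasurableSet[⨆ n, ℱ n] {ω | ∀ᶠ n in atTop, X n ω j < X n ω i} := by
  simp only [eventually_atTop, Set.ofPred_exists, Set.ofPred_forall]
  refine MeasurableSet.iUnion fun N => MeasurableSet.iInter fun n => MeasurableSet.iInter fun _ => ?_
  exact le_iSup (fun n => (ℱ n : MeasurableSpace Ω)) n _
    (measurableSet_lt ((measurable_pi_apply j).comp (h.adapted n))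
      ((measurable_pi_apply i).comp (h.adapted n)))

/-- Whenever `i` is not behind `j`, `N` forced draws of `i` followed by staying ahead have a
conditional probability bounded below, uniformly in time and past. Finiteness of the set of rankings
makes `δ` and `ε` uniform. -/
theorem ae_eventually_lt_of_frequently_le (h : IsDrawProcess q P ℱ X) (hpos : ∀ r c, 0 < q r c)
    {i j : Fin d} (hij : i ≠ j) (hdom : ∀ r : Ranking d, r.pos i < r.pos j → q r j < q r i) :
    ∀ᵐ ω ∂P, (∃ᶠ n in atTop, X n ω j ≤ X n ω i) → ∀ᶠ n in atTop, X n ω j < X n ω i := by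
  have := h.prob
  obtain ⟨δ, hδ, hδq⟩ := exists_pos_forall_le (f := fun p : Ranking d × Fin d => q p.1 p.2)
    fun p => hpos _ _
  obtain ⟨ε, hε, hεq⟩ := exists_pos_forall_le
    (f := fun r : {r : Ranking d // r.pos i < r.pos j} => q r.1 i - q r.1 j)
    fun r => sub_pos.2 (hdom r.1 r.2)
  let S : Finset (Fin d × Fin d) := {(i, j)}
  obtain ⟨N, hN⟩ := exists_nat_ge ((S.card + 1) / ε)
  have hη : 0 < (1 - S.card * Real.exp (-(S.card + 1 : ℝ))) * δ ^ N :=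
    mul_pos (sub_pos.2 (natCast_mul_exp_lt_one _)) (by positivity)
  refine ae_mem_of_frequently_mem (ℱ := ℱ) (B := fun n => {ω | X n ω j ≤ X n ω i})
    (h.measurableSet_eventually_lt i j) (fun n =>
      measurableSet_le ((measurable_pi_apply j).comp (h.adapted n))
        ((measurable_pi_apply i).comp (h.adapted n))) hη ?_
  intro n A hAB hA
  obtain ⟨G', hsub, hm, hP, hX⟩ := h.exists_forced hδ.le (Multiset.replicate N i)
    (fun c _ r => hδq (r, c)) n hA
  rw [Multiset.card_replicate] at hm hP hX
  have h1 := h.mul_measureReal_le_measureReal_inter_stay (S := S) hε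
    (fun r hr p hp => by
      obtain rfl := Finset.mem_singleton.1 hp
      exact hεq ⟨r, hr _ hp⟩) hm
    (fun ω hω p hp => by
      obtain rfl := Finset.mem_singleton.1 hp
      refine hN.trans ?_
      rw [hX ω hω, hX ω hω, Multiset.count_replicate_self, Multiset.count_replicate, if_neg hij]
      have : X n ω j ≤ X n ω i := hAB (hsub hω)
      simp only [Nat.cast_zero]
      linarith)
  rw [mul_assoc]
  refine (mul_le_mul_of_nonneg_left hP (sub_pos.2 (natCast_mul_exp_lt_one _)).le).trans
    (h1.trans (measureReal_mono ?_))
  rintro ω ⟨hω, hstay⟩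
  refine ⟨hsub hω, ?_⟩
  change ∀ᶠ n in atTop, X n ω j < X n ω i
  filter_upwards [eventually_ge_atTop (n + N)] with k hk
  obtain ⟨l, rfl⟩ := Nat.exists_eq_add_of_le hk
  exact hstay l (i, j) (Finset.mem_singleton_self _)

/-- For each pair, the colour with the favourable drift either is not behind infinitely often, and
then wins, or is eventually strictly behind. In both cases the order of the pair is eventually
strict and constant. -/
theorem ae_exists_eventually_rk_eq (h : IsDrawProcess q P ℱ X) (hpos : ∀ r c, 0 < q r c)
    (hdom : ∀ i j, i ≠ j → (∀ r : Ranking d, r.pos i < r.pos j → q r j < q r i) ∨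
      (∀ r : Ranking d, r.pos j < r.pos i → q r i < q r j)) :
    ∀ᵐ ω ∂P, ∃ r : Ranking d, (∀ i j, i ≠ j → r.pos i ≠ r.pos j) ∧
      ∀ᶠ n in atTop, rk (X n ω) = r := by
  have key : ∀ᵐ ω ∂P, ∀ i j, i ≠ j → (∀ᶠ n in atTop, X n ω j < X n ω i) ∨
      (∀ᶠ n in atTop, X n ω i < X n ω j) := by
    rw [ae_all_iff]; intro i
    rw [ae_all_iff]; intro j
    by_cases hij : i = j
    · exact ae_of_all _ fun ω hne => (hne hij).elim
    rcases hdom i j hij with hd | hd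
    · filter_upwards [h.ae_eventually_lt_of_frequently_le hpos hij hd] with ω hω _
      by_cases hf : ∃ᶠ n in atTop, X n ω j ≤ X n ω i
      · exact Or.inl (hω hf)
      · exact Or.inr ((not_frequently.1 hf).mono fun n hn => not_le.1 hn)
    · filter_upwards [h.ae_eventually_lt_of_frequently_le hpos (Ne.symm hij) hd] with ω hω _
      by_cases hf : ∃ᶠ n in atTop, X n ω i ≤ X n ω j
      · exact Or.inr (hω hf)
      · exact Or.inl ((not_frequently.1 hf).mono fun n hn => not_le.1 hn)
  filter_upwards [key] with ω hω
  have h1 : ∀ᶠ n in atTop, ∀ i j, i ≠ j → X n ω i ≠ X n ω j ∧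
      (X n ω j < X n ω i ↔ ∀ᶠ k in atTop, X k ω j < X k ω i) := by
    rw [eventually_all]; intro i
    rw [eventually_all]; intro j
    by_cases hij : i = j
    · exact Eventually.of_forall fun n hne => (hne hij).elim
    rcases hω i j hij with ht | ht
    · exact ht.mono fun n hn _ => ⟨hn.ne', iff_of_true hn ht⟩
    · refine ht.mono fun n hn _ => ⟨hn.ne, iff_of_false hn.not_gt fun ht' => ?_⟩
      obtain ⟨k, hk1, hk2⟩ := (ht.and ht').exists
      exact lt_asymm hk1 hk2
  obtain ⟨N, hN⟩ := h1.exists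
  refine ⟨rk (X N ω), rk_pos_ne fun i j hij => (hN i j hij).1, ?_⟩
  filter_upwards [h1] with n hn
  rw [rk_eq_iff]
  intro i j
  rw [rk_pos_lt_iff]
  by_cases hij : i = j
  · subst hij; simp
  · exact (hN i j hij).2.trans (hn i j hij).2.symm

theorem martingale_centredCount (h : IsDrawProcess q P ℱ X) (c : Fin d) :
    Martingale (centredCount q X c) ℱ P := by
  have := h.prob
  have hint : ∀ n, Integrable (centredCount q X c n) P := fun n =>
    Integrable.of_bound (((h.measurable_centredCount c n).mono
      (ℱ.le n) le_rfl)).aestronglyMeasurable n (ae_of_all _ fun ω => h.abs_centredCount_le c n ω)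
  refine martingale_of_setIntegral_eq_succ
    (fun n => (h.measurable_centredCount c n).stronglyMeasurable) hint fun n A hA => ?_
  have hi1 : Integrable ((draw X n c).indicator (1 : Ω → ℝ)) P :=
    (integrable_const _).indicator (h.measurableSet_draw' n c)
  have h1 : ∀ ω, centredCount q X c (n + 1) ω =
      centredCount q X c n ω + ((draw X n c).indicator 1 ω - q (rk (X n ω)) c) := fun ω => by
    simp only [centredCount, Finset.sum_range_succ]
  simp only [h1]
  have hi2 : Integrable (fun ω => (draw X n c).indicator (1 : Ω → ℝ) ω - q (rk (X n ω)) c) P :=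
    hi1.sub (h.integrable_prob n c)
  rw [integral_add (hint n).integrableOn hi2.integrableOn,
    integral_sub hi1.integrableOn (h.integrable_prob n c).integrableOn,
    ← h.measureReal_inter_draw hA, integral_indicator_one (h.measurableSet_draw' n c),
    measureReal_restrict_apply (h.measurableSet_draw' n c), Set.inter_comm, sub_self, add_zero]

/-- The eventual ranking agrees with the order of the means. -/
theorem ae_lt_of_eventually_rk_eq (h : IsDrawProcess q P ℱ X) (hpos : ∀ r c, 0 < q r c) :
    ∀ᵐ ω ∂P, ∀ r, (∀ᶠ n in atTop, rk (X n ω) = r) → ∀ i j, r.pos i < r.pos j →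
      q r j < q r i := by
  have := h.prob
  have hconv : ∀ᵐ ω ∂P, ∀ i j,
      BddBelow (Set.range fun n => centredCount q X i n ω - centredCount q X j n ω) →
      ∃ c, Tendsto (fun n => centredCount q X i n ω - centredCount q X j n ω) atTop (𝓝 c) := by
    rw [ae_all_iff]; intro i
    rw [ae_all_iff]; intro j
    have hM := (h.martingale_centredCount i).sub (h.martingale_centredCount j)
    have hb : ∀ᵐ ω ∂P, ∀ n, |(centredCount q X i - centredCount q X j) (n + 1) ω -
        (centredCount q X i - centredCount q X j) n ω| ≤ (2 : NNReal) := by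
      refine ae_of_all _ fun ω n => ?_
      simp only [Pi.sub_apply, centredCount, Finset.sum_range_succ]
      have h1 := abs_le.1 (h.abs_indicator_sub_le i n ω)
      have h2 := abs_le.1 (h.abs_indicator_sub_le j n ω)
      rw [abs_le]
      push_cast
      constructor <;> linarith
    filter_upwards [hM.bddAbove_range_iff_bddBelow_range hb,
      hM.submartingale.bddAbove_iff_exists_tendsto hb] with ω h1 h2 hbb
    exact h2.1 (h1.2 hbb)
  filter_upwards [hconv, h.ae_mem_limitEvent_of_eventually_rk_eq, h.exists_draw]
    with ω hω hlim hdraw r hr i j hij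
  by_contra! hle
  obtain ⟨N, hN⟩ := eventually_atTop.1 hr
  have hne : i ≠ j := by rintro rfl; exact lt_irrefl _ hij
  have hDpos : ∀ n ≥ N, X n ω j < X n ω i := fun n hn => by
    rw [← rk_pos_lt_iff, hN n hn]; exact hij
  let M : ℕ → ℝ := fun n => centredCount q X i n ω - centredCount q X j n ω
  have hMs : ∀ n ≥ N, M (n + 1) - M n = (X (n + 1) ω i - X n ω i) - (X (n + 1) ω j - X n ω j) -
      (q r i - q r j) := by
    intro n hn
    obtain ⟨c, hc⟩ := hdraw n
    have h1 : X (n + 1) ω = X n ω + Pi.single c 1 := hc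
    have h2 : ∀ a, (draw X n a).indicator (1 : Ω → ℝ) ω = X (n + 1) ω a - X n ω a := by
      intro a
      rw [h1, Pi.add_apply, add_sub_cancel_left]
      by_cases ha : a = c
      · subst ha; simp [hc]
      · rw [Set.indicator_of_notMem (fun h' => ha (draw_disjoint h' hc)), Pi.single_eq_of_ne ha]
    simp only [M, centredCount, Finset.sum_range_succ, hN n hn, h2]
    ring
  -- With `q r i ≤ q r j` the martingale grows at least as fast as the gap, which is positive from
  -- `N` on; hence it is bounded below.
  have hlow : ∀ n ≥ N, M N - (X N ω i - X N ω j) ≤ M n - (X n ω i - X n ω j) := by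
    intro n hn
    induction n, hn using Nat.le_induction with
    | base => exact le_rfl
    | succ n hn ih => linarith [hMs n hn]
  have hbb : BddBelow (Set.range M) := by
    have : IsBoundedUnder (· ≥ ·) atTop M :=
      isBoundedUnder_of_eventually_ge (a := M N - (X N ω i - X N ω j))
        ((eventually_ge_atTop N).mono fun n hn => by linarith [hlow n hn, hDpos n hn])
    exact this.bddBelow_range
  obtain ⟨l, hl⟩ := hω i j hbb
  have hdiff : Tendsto (fun n => M (n + 1) - M n) atTop (𝓝 0) := by
    have := ((tendsto_add_atTop_iff_nat 1).2 hl).sub hl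
    rwa [sub_self] at this
  -- Drawing `i` would raise the martingale by `1 - (q r i - q r j) ≥ 1`, impossible once its
  -- increments are small.
  have hsmall : ∀ᶠ n in atTop, ω ∉ draw X n i := by
    filter_upwards [hdiff.eventually_lt_const one_pos, eventually_ge_atTop N] with n hn hnN hd
    rw [hMs n hnN] at hn
    have h1 : X (n + 1) ω = X n ω + Pi.single i 1 := hd
    rw [h1] at hn
    simp only [Pi.add_apply, Pi.single_eq_same, Pi.single_eq_of_ne hne.symm] at hn
    linarith
  obtain ⟨K, hK⟩ := eventually_atTop.1 hsmall
  have hconst : ∀ n ≥ K, X n ω i = X K ω i := by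
    intro n hn
    induction n, hn using Nat.le_induction with
    | base => rfl
    | succ n hn ih =>
      obtain ⟨c, hc⟩ := hdraw n
      have hci : i ≠ c := by rintro rfl; exact hK n hn hc
      have h1 : X (n + 1) ω = X n ω + Pi.single c 1 := hc
      rw [h1, Pi.add_apply, Pi.single_eq_of_ne hci, add_zero, ih]
  have h1 : Tendsto (fun n : ℕ => (n : ℝ)⁻¹ * X K ω i) atTop (𝓝 0) := by
    simpa using tendsto_inv_atTop_nhds_zero_nat.mul_const (X K ω i)
  have h2 : Tendsto (fun n : ℕ => (n : ℝ)⁻¹ * X n ω i) atTop (𝓝 (q r i)) :=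
    tendsto_pi_nhds.1 (hlim r hr) i
  have h3 : Tendsto (fun n : ℕ => (n : ℝ)⁻¹ * X n ω i) atTop (𝓝 0) :=
    h1.congr' ((eventually_ge_atTop K).mono fun n hn => by simp only [hconst n hn])
  exact (hpos r i).ne' (tendsto_nhds_unique h2 h3)

end IsDrawProcess

/-! ### Existence -/

section Existence

open Kernel Preorder

variable (μ : Ranking d → Measure (Fin d → ℝ)) [∀ r, IsProbabilityMeasure (μ r)]

/-- The transition kernels of the ranking-based process, as functions of the whole past. -/
noncomputable def pastKernel (n : ℕ) :
    Kernel (Π _ : Finset.Iic n, Fin d → ℝ) (Fin d → ℝ) :=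
  (stepKernel μ).comap (fun h => h ⟨n, Finset.mem_Iic.2 le_rfl⟩) (by fun_prop)

instance (n : ℕ) : IsMarkovKernel (pastKernel μ n) := by
  unfold pastKernel
  infer_instance

/-- The Ionescu-Tulcea measure `traj` on path space, with coordinate process and canonical
filtration. It makes the existence statement for `ν` non-vacuous. -/
theorem exists_isRankingBasedProcess {μ : Ranking d → Measure (Fin d → ℝ)}
    (hμ : IsIncrementFamily μ) (x₀ : Fin d → ℝ) :
    ∃ (Ω : Type) (mΩ : MeasurableSpace Ω) (P : Measure Ω) (ℱ : Filtration ℕ mΩ)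
        (X : ℕ → Ω → Fin d → ℝ), IsRankingBasedProcess μ (Measure.dirac x₀) P ℱ X := by
  have := hμ.prob
  let P : Measure (ℕ → Fin d → ℝ) :=
    traj (X := fun _ => Fin d → ℝ) (pastKernel μ) 0 (fun _ => x₀)
  refine ⟨ℕ → Fin d → ℝ, inferInstance, P,
    Filtration.piLE (X := fun _ => Fin d → ℝ), fun n ω => ω n, hμ, ?_, ?_, ?_, ?_, ?_⟩
  · infer_instance
  · intro n
    rw [Filtration.piLE_eq_comap_frestrictLe]
    have : (fun ω : ℕ → Fin d → ℝ => ω n) =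
        (fun h : (Π _ : Finset.Iic n, Fin d → ℝ) => h ⟨n, Finset.mem_Iic.2 le_rfl⟩) ∘
          frestrictLe (π := fun _ => Fin d → ℝ) n := rfl
    rw [this]
    exact (measurable_pi_apply _).comp (comap_measurable _)
  · have h1 : P.map (frestrictLe (π := fun _ => Fin d → ℝ) 0) = Measure.dirac (fun _ => x₀) := by
      rw [← Kernel.map_apply _ (measurable_frestrictLe _), traj_map_frestrictLe, partialTraj_self,
        Kernel.id_apply]
    let e : (Π _ : Finset.Iic 0, Fin d → ℝ) → Fin d → ℝ := fun h => h ⟨0, Finset.mem_Iic.2 le_rfl⟩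
    have he : Measurable e := measurable_pi_apply _
    have h2 := Measure.map_map (μ := P) he
      (measurable_frestrictLe (X := fun _ => Fin d → ℝ) 0)
    rw [h1, Measure.map_dirac' he] at h2
    exact h2.symm
  · exact fun i => (memLp_const (x₀ i)).ae_eq ((ae_dirac_eq x₀).symm ▸ rfl)
  · intro n B hB
    have hB' : MeasurableSet ((fun ω : ℕ → Fin d → ℝ => ω (n + 1)) ⁻¹' B) :=
      (measurable_pi_apply (n + 1)) hB
    have hint : Integrable (((fun ω : ℕ → Fin d → ℝ => ω (n + 1)) ⁻¹' B).indicator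
        (fun _ => (1 : ℝ))) P := (integrable_const _).indicator hB'
    have hce := condExp_traj (X := fun _ => Fin d → ℝ) (κ := pastKernel μ) (a := 0) (b := n)
      (x₀ := fun _ => x₀) (Nat.zero_le n) hint
    refine hce.trans (ae_of_all _ fun ω => ?_)
    have h1 : (traj (X := fun _ => Fin d → ℝ) (pastKernel μ) n (frestrictLe n ω)).map
        (fun y => y (n + 1)) = stepKernel μ (ω n) := by
      rw [← Kernel.map_apply _ (measurable_pi_apply _), map_traj_succ_self]
      rfl
    have h2 : transition μ (ω n) B =
        (traj (X := fun _ => Fin d → ℝ) (pastKernel μ) n (frestrictLe n ω)).real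
          ((fun y => y (n + 1)) ⁻¹' B) := by
      have hm : Measurable fun y : ℕ → Fin d → ℝ => y (n + 1) := measurable_pi_apply (n + 1)
      rw [← stepKernel_real μ _ hB, ← h1, measureReal_def, Measure.map_apply hm hB, measureReal_def]
    exact (integral_indicator_one hB').trans h2.symm

end Existence

/-! ### The central limit theorem -/

open scoped Classical in
/-- The normalised exponential of an increment, while the ranking is `r`; otherwise `1`. -/
noncomputable def tiltFactor {Ω : Type*} (r : Ranking d) (i : Fin d) (p t : ℝ) (ψ : ℂ)
    (X : ℕ → Ω → Fin d → ℝ) (k : ℕ) (ω : Ω) : ℂ :=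
  if rk (X k ω) = r then
    Complex.exp ((t * (X (k + 1) ω i - X k ω i - p) : ℝ) * Complex.I) / ψ else 1

theorem norm_tiltFactor_le {Ω : Type*} (r : Ranking d) (i : Fin d) (p t : ℝ) {ψ : ℂ}
    (hψ : ψ ≠ 0) (hψ1 : ‖ψ‖ ≤ 1) (X : ℕ → Ω → Fin d → ℝ) (k : ℕ) (ω : Ω) :
    ‖tiltFactor r i p t ψ X k ω‖ ≤ ‖ψ‖⁻¹ := by
  unfold tiltFactor
  split_ifs
  · rw [norm_div, Complex.norm_exp_ofReal_mul_I, one_div]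
  · rw [norm_one]
    exact (one_le_inv₀ (norm_pos_iff.2 hψ)).2 hψ1

theorem norm_prod_tiltFactor_le {Ω : Type*} (r : Ranking d) (i : Fin d) (p t : ℝ) {ψ : ℂ}
    (hψ : ψ ≠ 0) (hψ1 : ‖ψ‖ ≤ 1) (X : ℕ → Ω → Fin d → ℝ) (m k : ℕ) (ω : Ω) :
    ‖∏ l ∈ Finset.range k, tiltFactor r i p t ψ X (m + l) ω‖ ≤ ‖ψ‖⁻¹ ^ k := by
  rw [norm_prod]
  refine (Finset.prod_le_prod (fun _ _ => norm_nonneg _)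
    fun l _ => norm_tiltFactor_le r i p t hψ hψ1 X (m + l) ω).trans (by simp)

theorem prod_tiltFactor_eq {Ω : Type*} {r : Ranking d} (i : Fin d) (p t : ℝ) (ψ : ℂ)
    {X : ℕ → Ω → Fin d → ℝ} {m : ℕ} {ω : Ω} (hω : ∀ k ≥ m, rk (X k ω) = r) (k : ℕ) :
    ∏ l ∈ Finset.range k, tiltFactor r i p t ψ X (m + l) ω =
      Complex.exp ((t * (X (m + k) ω i - X m ω i - k * p) : ℝ) * Complex.I) / ψ ^ k := by
  induction k with
  | zero => simp
  | succ k ih =>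
    rw [Finset.prod_range_succ, ih, tiltFactor, if_pos (hω _ (Nat.le_add_right _ _)),
      div_mul_div_comm, ← Complex.exp_add, ← pow_succ]
    congr 2
    rw [← add_assoc]
    push_cast
    ring

namespace IsDrawProcess

variable {q : Ranking d → Fin d → ℝ} {Ω : Type*} {mΩ : MeasurableSpace Ω}
    {P : Measure Ω} {ℱ : Filtration ℕ mΩ} {X : ℕ → Ω → Fin d → ℝ}

theorem measurable_tiltFactor (h : IsDrawProcess q P ℱ X) (r : Ranking d) (i : Fin d) (p t : ℝ)
    (ψ : ℂ) (k : ℕ) : Measurable[ℱ (k + 1)] (tiltFactor r i p t ψ X k) := by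
  unfold tiltFactor
  have h1 : Measurable[ℱ (k + 1)] fun ω => X (k + 1) ω i :=
    (measurable_pi_apply i).comp (h.adapted _)
  have h2 : Measurable[ℱ (k + 1)] fun ω => X k ω i :=
    ((measurable_pi_apply i).comp (h.adapted _)).mono (ℱ.mono k.le_succ) le_rfl
  refine Measurable.ite ?_ ?_ measurable_const
  · exact ((h.measurable_rk k).mono (ℱ.mono k.le_succ) le_rfl) (measurableSet_singleton r)
  · refine Measurable.div_const (Complex.measurable_exp.comp (Measurable.mul_const ?_ _)) _
    exact Complex.measurable_ofReal.comp (((h1.sub h2).sub_const p).const_mul t)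

theorem measurable_prod_tiltFactor (h : IsDrawProcess q P ℱ X) (r : Ranking d) (i : Fin d)
    (p t : ℝ) (ψ : ℂ) (m k : ℕ) : Measurable[ℱ (m + k)] fun ω =>
      ∏ l ∈ Finset.range k, tiltFactor r i p t ψ X (m + l) ω := by
  refine Finset.measurable_fun_prod _ fun l hl => ?_
  refine (h.measurable_tiltFactor r i p t ψ (m + l)).mono (ℱ.mono ?_) le_rfl
  have := Finset.mem_range.1 hl
  omega

open scoped Classical in
-- Each factor has conditional mean `1`: at ranking `r` because `ψ` is the mean of the exponential,
-- elsewhere because the factor is `1`. Factors are removed one at a time from the last.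
theorem integral_mul_prod_tiltFactor (h : IsDrawProcess q P ℱ X) (r : Ranking d) (i : Fin d)
    (p t : ℝ) {ψ : ℂ} (hψ : ψ ≠ 0) (hψ1 : ‖ψ‖ ≤ 1)
    (hψe : ∑ c, q r c • Complex.exp ((t * ((Pi.single c 1 : Fin d → ℝ) i - p) : ℝ) * Complex.I) = ψ)
    {m : ℕ} {g : Ω → ℂ} (hg : Measurable[ℱ m] g) (hg1 : ∀ ω, ‖g ω‖ ≤ 1) (k : ℕ) :
    ∫ ω, g ω * ∏ l ∈ Finset.range k, tiltFactor r i p t ψ X (m + l) ω ∂P = ∫ ω, g ω ∂P := by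
  induction k with
  | zero => simp
  | succ k ih =>
    rw [← ih]
    let W : Ω → ℂ := fun ω => g ω * ∏ l ∈ Finset.range k, tiltFactor r i p t ψ X (m + l) ω
    let F : Fin d → Ω → ℂ := fun c ω => if rk (X (m + k) ω) = r then
      Complex.exp ((t * ((Pi.single c 1 : Fin d → ℝ) i - p) : ℝ) * Complex.I) / ψ else 1
    have hWm : Measurable[ℱ (m + k)] W :=
      (hg.mono (ℱ.mono (Nat.le_add_right _ _)) le_rfl).mul
        (h.measurable_prod_tiltFactor r i p t ψ m k)
    have hWb : ∀ ω, ‖W ω‖ ≤ ‖ψ‖⁻¹ ^ k := fun ω => by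
      rw [norm_mul]
      exact (mul_le_of_le_one_left (norm_nonneg _) (hg1 ω)).trans
        (norm_prod_tiltFactor_le r i p t hψ hψ1 X m k ω)
    have hFm : ∀ c, Measurable[ℱ (m + k)] (F c) := fun c =>
      Measurable.ite ((h.measurable_rk (m + k)) (measurableSet_singleton r)) measurable_const
        measurable_const
    have hFb : ∀ c ω, ‖F c ω‖ ≤ ‖ψ‖⁻¹ := by
      intro c ω
      simp only [F]
      split_ifs
      · rw [norm_div, Complex.norm_exp_ofReal_mul_I, one_div]
      · rw [norm_one]
        exact (one_le_inv₀ (norm_pos_iff.2 hψ)).2 hψ1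
    rw [h.integral_step (m + k) (Y := fun c ω => W ω * F c ω) (C := ‖ψ‖⁻¹ ^ k * ‖ψ‖⁻¹)
      (fun c => (hWm.mul (hFm c)).stronglyMeasurable) ?_ ?_]
    · refine integral_congr_ae (ae_of_all _ fun ω => ?_)
      have h1 : ∑ c, q (rk (X (m + k) ω)) c • F c ω = 1 := by
        by_cases hr : rk (X (m + k) ω) = r
        · simp only [F, if_pos hr, hr, ← smul_div_assoc, ← Finset.sum_div, hψe, div_self hψ]
        · simp only [F, if_neg hr, ← Finset.sum_smul, h.sum_eq, one_smul]
      calc ∑ c, q (rk (X (m + k) ω)) c • (W ω * F c ω)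
          = W ω * ∑ c, q (rk (X (m + k) ω)) c • F c ω := by
            rw [Finset.mul_sum]
            exact Finset.sum_congr rfl fun c _ => (mul_smul_comm _ _ _).symm
        _ = W ω := by rw [h1, mul_one]
    · intro c ω
      rw [norm_mul]
      exact mul_le_mul (hWb ω) (hFb c ω) (norm_nonneg _) (by positivity)
    · intro c ω hω
      have h1 : X (m + k + 1) ω = X (m + k) ω + Pi.single c 1 := hω
      rw [Finset.prod_range_succ, ← mul_assoc]
      congr 1
      simp only [tiltFactor, F, h1, Pi.add_apply, add_sub_cancel_left]

/-- Characteristic functions on an event where the ranking is eventually `r`. -/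
theorem tendsto_setIntegral_exp (h : IsDrawProcess q P ℱ X) {r : Ranking d} {i : Fin d} {p : ℝ}
    {t : ℕ → ℝ} (ht : Tendsto t atTop (𝓝 0)) {ψ : ℕ → ℂ}
    (hψe : ∀ n, ∑ c, q r c •
      Complex.exp ((t n * ((Pi.single c 1 : Fin d → ℝ) i - p) : ℝ) * Complex.I) = ψ n)
    {l : ℂ} (hl : l ≠ 0) (hψl : Tendsto (fun n => ψ n ^ n) atTop (𝓝 l)) {E : Set Ω}
    (hE : MeasurableSet[⨆ n, ℱ n] E) (hEr : ∀ ω ∈ E, ∀ᶠ n in atTop, rk (X n ω) = r) :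
    Tendsto (fun n : ℕ => ∫ ω in E, Complex.exp ((t n * (X n ω i - n * p) : ℝ) * Complex.I) ∂P)
      atTop (𝓝 (P.real E * l)) := by
  have := h.prob
  have hE' : MeasurableSet E := (iSup_le fun n => ℱ.le n) _ hE
  have hψ1 : ∀ n, ‖ψ n‖ ≤ 1 := by
    intro n
    rw [← hψe n, ← h.sum_eq r]
    refine (norm_sum_le _ _).trans (Finset.sum_le_sum fun c _ => ?_)
    rw [norm_smul, Complex.norm_exp_ofReal_mul_I, mul_one, Real.norm_eq_abs,
      abs_of_nonneg (h.nonneg r c)]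
  have hψ_lim : Tendsto ψ atTop (𝓝 1) := by
    have hc : Continuous fun s : ℝ => ∑ c, q r c •
        Complex.exp ((s * ((Pi.single c 1 : Fin d → ℝ) i - p) : ℝ) * Complex.I) := by fun_prop
    have := (hc.tendsto 0).comp ht
    simp only [zero_mul, Complex.ofReal_zero, Complex.exp_zero, ← Finset.sum_smul, h.sum_eq,
      one_smul] at this
    exact this.congr hψe
  have hψ0 : ∀ᶠ n in atTop, ψ n ≠ 0 := hψ_lim.eventually_ne one_ne_zero
  -- the `L¹`-approximation of the indicator function of `E`
  let e : Ω → ℝ := E.indicator 1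
  have he_int : Integrable e P := (integrable_const 1).indicator hE'
  have he01 : ∀ ω, 0 ≤ e ω ∧ e ω ≤ 1 := by
    intro ω
    by_cases hω : ω ∈ E <;> simp [e, hω]
  obtain ⟨g, hgm, hg01, hgi, hgE⟩ : ∃ g : ℕ → Ω → ℝ, (∀ m, Measurable[ℱ m] (g m)) ∧
      (∀ m ω, 0 ≤ g m ω ∧ g m ω ≤ 1) ∧ (∀ m, ∫ ω, g m ω ∂P = P.real E) ∧
      Tendsto (fun m => ∫ ω, |e ω - g m ω| ∂P) atTop (𝓝 0) := by
    have hclip : ∀ m, (fun ω => max 0 (min 1 (P[e | ℱ m] ω))) =ᵐ[P] P[e | ℱ m] := by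
      intro m
      have h0 : (0 : Ω → ℝ) ≤ᵐ[P] P[e | ℱ m] := condExp_nonneg (ae_of_all _ fun ω => (he01 ω).1)
      have h1 : P[e | ℱ m] ≤ᵐ[P] P[(fun _ => (1 : ℝ)) | ℱ m] :=
        condExp_mono he_int (integrable_const _) (ae_of_all _ fun ω => (he01 ω).2)
      rw [condExp_const (ℱ.le m)] at h1
      filter_upwards [h0, h1] with ω hω0 hω1
      rw [min_eq_right hω1]
      exact max_eq_right hω0
    -- Clipping turns the almost sure bounds on the conditional expectation into bounds at every
    -- point.
    refine ⟨fun m ω => max 0 (min 1 (P[e | ℱ m] ω)), fun m => ?_, fun m ω => ?_, fun m => ?_, ?_⟩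
    · exact measurable_const.max (measurable_const.min stronglyMeasurable_condExp.measurable)
    · exact ⟨le_max_left _ _, max_le zero_le_one (min_le_left _ _)⟩
    · rw [integral_congr_ae (hclip m), integral_condExp]
      exact integral_indicator_one hE'
    · have hlim := he_int.tendsto_ae_condExp (ℱ := ℱ)
        ((stronglyMeasurable_one (α := Ω) (β := ℝ)).indicator hE)
      suffices hs : Tendsto (fun m => ∫ ω, |e ω - max 0 (min 1 (P[e | ℱ m] ω))| ∂P) atTop
          (𝓝 (∫ _, (0 : ℝ) ∂P)) by simpa only [integral_zero] using hs
      refine tendsto_integral_of_dominated_convergence (fun _ => 1) (fun m => ?_)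
        (integrable_const _) (fun m => ae_of_all _ fun ω => ?_) ?_
      · refine (Measurable.aestronglyMeasurable ?_)
        exact continuous_abs.measurable.comp ((measurable_one.indicator hE').sub
          (measurable_const.max (measurable_const.min
            (stronglyMeasurable_condExp.mono (ℱ.le m)).measurable)))
      · rw [Real.norm_eq_abs, abs_abs, abs_le]
        have h1 := he01 ω
        have h2 : 0 ≤ max 0 (min 1 (P[e | ℱ m] ω)) := le_max_left _ _
        have h3 : max 0 (min 1 (P[e | ℱ m] ω)) ≤ 1 := max_le zero_le_one (min_le_left _ _)
        constructor <;> linarith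
      · filter_upwards [hlim, ae_all_iff.2 hclip] with ω hω hc
        have h1 := ((tendsto_const_nhds (x := e ω)).sub hω).abs
        simp only [e, sub_self, abs_zero] at h1
        exact h1.congr fun m => by simp only [e, hc m]
  -- the events that the ranking is `r` from time `m` on
  let F : ℕ → Set Ω := fun m => {ω | ∀ k ≥ m, rk (X k ω) = r}
  have hFm : ∀ m, MeasurableSet (F m) := by
    intro m
    simp only [F, Set.ofPred_forall]
    exact MeasurableSet.iInter fun k => MeasurableSet.iInter fun _ =>
      ((h.measurable_rk k).mono (ℱ.le k) le_rfl) (measurableSet_singleton r)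
  have hEF : Tendsto (fun m => P.real (E \ F m)) atTop (𝓝 0) := by
    have hanti : Antitone fun m => E \ F m := fun a b hab =>
      Set.sdiff_subset_sdiff_right fun ω hω k hk => hω k (hab.trans hk)
    have h1 := tendsto_measure_iInter_atTop (μ := P)
      (fun m => (hE'.diff (hFm m)).nullMeasurableSet) hanti ⟨0, measure_ne_top _ _⟩
    have h2 : ⋂ m, E \ F m = ∅ := by
      refine Set.eq_empty_of_forall_notMem fun ω hω => ?_
      rw [Set.mem_iInter] at hω
      obtain ⟨N, hN⟩ := eventually_atTop.1 (hEr ω (hω 0).1)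
      exact (hω N).2 hN
    rw [h2, measure_empty] at h1
    exact (ENNReal.tendsto_toReal ENNReal.zero_ne_top).comp h1
  let a : ℕ → ℂ := fun n => ∫ ω in E, Complex.exp ((t n * (X n ω i - n * p) : ℝ) * Complex.I) ∂P
  -- The contribution of the first `m` draws, which separates the tilted product started at `m` from
  -- the full normalised exponential. It tends to `1` as `n → ∞` with `m` fixed.
  let cc : ℕ → ℕ → Ω → ℂ := fun m n ω =>
    Complex.exp ((-(t n * (X m ω i - m * p)) : ℝ) * Complex.I) * ψ n ^ m
  have hXm : ∀ n, Measurable fun ω => X n ω i := fun n =>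
    (measurable_pi_apply i).comp (h.measurable n)
  have hcm : ∀ m n, Measurable (cc m n) := fun m n =>
    (Complex.measurable_exp.comp (Measurable.mul_const (Complex.measurable_ofReal.comp
      (((hXm m).sub_const _).const_mul _).neg) _)).mul_const _
  have hcb : ∀ m n ω, ‖cc m n ω‖ ≤ 1 := fun m n ω => by
    rw [norm_mul, Complex.norm_exp_ofReal_mul_I, one_mul, norm_pow]
    exact pow_le_one₀ (norm_nonneg _) (hψ1 n)
  have hclim : ∀ m, Tendsto (fun n => ∫ ω, ‖1 - cc m n ω‖ ∂P) atTop (𝓝 0) := by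
    intro m
    suffices hs : Tendsto (fun n => ∫ ω, ‖1 - cc m n ω‖ ∂P) atTop (𝓝 (∫ _, (0 : ℝ) ∂P)) by
      simpa only [integral_zero] using hs
    refine tendsto_integral_of_dominated_convergence (fun _ => 2) (fun n => ?_)
      (integrable_const _) (fun n => ae_of_all _ fun ω => ?_) (ae_of_all _ fun ω => ?_)
    · exact ((measurable_const.sub (hcm m n)).norm).aestronglyMeasurable
    · rw [norm_norm]
      refine (norm_sub_le _ _).trans ?_
      rw [norm_one]
      linarith [hcb m n ω]
    · have hc : Continuous fun s : ℝ =>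
          Complex.exp ((-(s * (X m ω i - m * p)) : ℝ) * Complex.I) := by fun_prop
      have h1 := ((hc.tendsto 0).comp ht).mul (hψ_lim.pow m)
      have h2 := ((tendsto_const_nhds (x := (1 : ℂ))).sub h1).norm
      simpa [cc, Function.comp_def] using h2
  -- The three errors come from replacing the indicator of `E` by `g m`, from ignoring the first `m`
  -- draws, and from paths in `E` whose ranking has not settled by time `m`.
  have hbound : ∀ m, ∀ᶠ n in atTop, ‖a n / ψ n ^ n - P.real E‖ ≤ ‖(ψ n ^ n)⁻¹‖ *
      ((∫ ω, |e ω - g m ω| ∂P) + (∫ ω, ‖1 - cc m n ω‖ ∂P) + 2 * P.real (E \ F m)) := by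
    intro m
    filter_upwards [hψ0, eventually_ge_atTop m] with n hn hmn
    obtain ⟨k, rfl⟩ := Nat.exists_eq_add_of_le hmn
    set N := m + k with hN
    let W : Ω → ℂ := fun ω =>
      g m ω * ∏ j ∈ Finset.range k, tiltFactor r i p (t N) (ψ N) X (m + j) ω
    have hg1 : ∀ ω, ‖(g m ω : ℂ)‖ ≤ 1 := fun ω => by
      rw [Complex.norm_real, Real.norm_eq_abs, abs_of_nonneg (hg01 m ω).1]; exact (hg01 m ω).2
    have hgm' : Measurable[ℱ m] fun ω => (g m ω : ℂ) := Complex.measurable_ofReal.comp (hgm m)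
    have hW : ∫ ω, W ω ∂P = P.real E := by
      rw [h.integral_mul_prod_tiltFactor r i p (t N) hn (hψ1 N) (hψe N) hgm' hg1 k,
        integral_complex_ofReal, hgi]
    have hWm : Measurable W := (hgm'.mono (ℱ.le _) le_rfl).mul
      ((h.measurable_prod_tiltFactor r i p (t N) (ψ N) m k).mono (ℱ.le _) le_rfl)
    have hinv : ‖ψ N‖⁻¹ ^ k ≤ ‖(ψ N ^ N)⁻¹‖ := by
      rw [norm_inv, norm_pow, ← inv_pow]
      exact pow_le_pow_right₀ ((one_le_inv₀ (norm_pos_iff.2 hn)).2 (hψ1 N)) (by omega)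
    have hWb : ∀ ω, ‖W ω‖ ≤ ‖(ψ N ^ N)⁻¹‖ * g m ω := fun ω => by
      rw [norm_mul, mul_comm, Complex.norm_real, Real.norm_eq_abs, abs_of_nonneg (hg01 m ω).1]
      exact mul_le_mul_of_nonneg_right ((norm_prod_tiltFactor_le r i p (t N) hn (hψ1 N) X m k
        ω).trans hinv) (hg01 m ω).1
    have hWint : Integrable W P := Integrable.of_bound hWm.aestronglyMeasurable ‖(ψ N ^ N)⁻¹‖
      (ae_of_all _ fun ω => (hWb ω).trans (mul_le_of_le_one_right (norm_nonneg _) (hg01 m ω).2))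
    let Φ : Ω → ℂ := fun ω =>
      Complex.exp ((t N * (X N ω i - N * p) : ℝ) * Complex.I) / ψ N ^ N
    have hΦm : Measurable Φ := (Complex.measurable_exp.comp (Measurable.mul_const
      (Complex.measurable_ofReal.comp (((hXm N).sub_const _).const_mul _)) _)).div_const _
    have hΦn : ∀ ω, ‖Φ ω‖ = ‖(ψ N ^ N)⁻¹‖ := fun ω => by
      rw [norm_div, Complex.norm_exp_ofReal_mul_I, norm_inv, one_div]
    have hΦint : Integrable (E.indicator Φ) P := Integrable.indicator
      (Integrable.of_bound hΦm.aestronglyMeasurable _ (ae_of_all _ fun ω => (hΦn ω).le)) hE'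
    have ha : a N / ψ N ^ N = ∫ ω, E.indicator Φ ω ∂P := by
      rw [integral_indicator hE', integral_div]
    rw [ha, ← hW, ← integral_sub hΦint hWint]
    have hi1 : Integrable (fun ω => |e ω - g m ω|) P :=
      (he_int.sub (Integrable.of_bound ((hgm m).mono (ℱ.le m) le_rfl).aestronglyMeasurable 1
        (ae_of_all _ fun ω => by
          rw [Real.norm_eq_abs, abs_of_nonneg (hg01 m ω).1]; exact (hg01 m ω).2))).abs
    have hi2 : Integrable (fun ω => ‖1 - cc m N ω‖) P :=
      ((integrable_const (1 : ℂ)).sub (Integrable.of_bound (hcm m N).aestronglyMeasurable 1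
        (ae_of_all _ (hcb m N)))).norm
    have hi3 : Integrable ((E \ F m).indicator fun _ => (2 : ℝ)) P :=
      (integrable_const _).indicator (hE'.diff (hFm m))
    have hi : Integrable (fun ω => |e ω - g m ω| + ‖1 - cc m N ω‖ +
        (E \ F m).indicator (fun _ => (2 : ℝ)) ω) P := (hi1.add hi2).add hi3
    refine (norm_integral_le_of_norm_le (hi.const_mul ‖(ψ N ^ N)⁻¹‖)
      (ae_of_all _ fun ω => ?_)).trans (le_of_eq ?_)
    · by_cases hF : ω ∈ F m
      · have hWe : W ω = Φ ω * (g m ω * cc m N ω) := by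
          simp only [W, Φ, cc]
          rw [prod_tiltFactor_eq i p (t N) (ψ N) hF k]
          have hpow : ψ N ^ N = ψ N ^ m * ψ N ^ k := by rw [hN, pow_add]
          have hexp : Complex.exp ((t N * (X (m + k) ω i - X m ω i - k * p) : ℝ) * Complex.I) =
              Complex.exp ((t N * (X N ω i - N * p) : ℝ) * Complex.I) *
              Complex.exp ((-(t N * (X m ω i - m * p)) : ℝ) * Complex.I) := by
            rw [← Complex.exp_add, ← add_mul, ← Complex.ofReal_add]
            congr 3
            rw [hN]
            push_cast
            ring
          rw [hexp, hpow]
          field_simp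
        have hEe : E.indicator Φ ω = Φ ω * e ω := by
          by_cases hω : ω ∈ E <;> simp [e, hω]
        rw [hWe, hEe, ← mul_sub, norm_mul, hΦn]
        refine mul_le_mul_of_nonneg_left ?_ (norm_nonneg _)
        have h1 : (e ω : ℂ) - g m ω * cc m N ω =
            ((e ω - g m ω : ℝ) : ℂ) + g m ω * (1 - cc m N ω) := by push_cast; ring
        have h2 : 0 ≤ (E \ F m).indicator (fun _ => (2 : ℝ)) ω :=
          Set.indicator_nonneg (fun _ _ => zero_le_two) _
        rw [h1]
        refine (norm_add_le _ _).trans ?_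
        rw [Complex.norm_real, Real.norm_eq_abs, norm_mul]
        have h3 := mul_le_of_le_one_left (norm_nonneg (1 - cc m N ω)) (hg1 ω)
        linarith
      · refine (norm_sub_le _ _).trans ?_
        have h1 : ‖E.indicator Φ ω‖ ≤ ‖(ψ N ^ N)⁻¹‖ * e ω := by
          by_cases hω : ω ∈ E
          · simp only [Set.indicator_of_mem hω, hΦn, e, Pi.one_apply, mul_one, le_refl]
          · simp [hω, e]
        have h2 : e ω + g m ω ≤ |e ω - g m ω| + ‖1 - cc m N ω‖ +
            (E \ F m).indicator (fun _ => (2 : ℝ)) ω := by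
          have h3 := norm_nonneg (1 - cc m N ω)
          by_cases hω : ω ∈ E
          · rw [Set.indicator_of_mem (show ω ∈ E \ F m from ⟨hω, hF⟩)]
            linarith [(he01 ω).2, (hg01 m ω).2, abs_nonneg (e ω - g m ω)]
          · rw [Set.indicator_of_notMem fun h' => hω h'.1]
            have h4 : e ω = 0 := Set.indicator_of_notMem hω _
            rw [h4, zero_sub, abs_neg, abs_of_nonneg (hg01 m ω).1]
            linarith
        have h3 := mul_le_mul_of_nonneg_left h2 (norm_nonneg (ψ N ^ N)⁻¹)
        rw [mul_add] at h3
        linarith [hWb ω]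
    · rw [integral_const_mul, integral_add (f := fun ω => |e ω - g m ω| + ‖1 - cc m N ω‖) (hi1.add hi2) hi3, integral_add hi1 hi2,
        integral_indicator (hE'.diff (hFm m))]
      simp only [integral_const, measureReal_restrict_apply_univ, smul_eq_mul]
      ring
  have hK : Tendsto (fun n => ‖(ψ n ^ n)⁻¹‖) atTop (𝓝 ‖l⁻¹‖) := (hψl.inv₀ hl).norm
  have hquot : Tendsto (fun n => a n / ψ n ^ n) atTop (𝓝 (P.real E)) := by
    rw [tendsto_iff_norm_sub_tendsto_zero]
    refine squeeze_zero' (g := fun n => ‖a n / ψ n ^ n - P.real E‖)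
      (Eventually.of_forall fun n => norm_nonneg _) (Eventually.of_forall fun n => le_rfl) ?_
    rw [Metric.tendsto_nhds]
    intro ε hε
    -- Order of limits: `m` is fixed first to make the first and third errors small, then `n → ∞`
    -- removes the second.
    have hm : ∀ᶠ m in atTop, ‖l⁻¹‖ * ((∫ ω, |e ω - g m ω| ∂P) + 0 + 2 * P.real (E \ F m)) < ε := by
      have h1 := ((hgE.add_const 0).add (hEF.const_mul 2)).const_mul ‖l⁻¹‖
      simp only [add_zero, mul_zero] at h1 ⊢
      exact h1.eventually_lt_const hε
    obtain ⟨m, hm⟩ := hm.exists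
    have hn := (hK.mul (((tendsto_const_nhds (x := ∫ ω, |e ω - g m ω| ∂P)).add (hclim m)).add
      (tendsto_const_nhds (x := 2 * P.real (E \ F m))))).eventually_lt_const hm
    filter_upwards [hn, hbound m] with n h1 h2
    rw [dist_zero_right, norm_norm]
    exact h2.trans_lt h1
  refine (hquot.mul hψl).congr' ?_
  filter_upwards [hψ0] with n hn
  exact div_mul_cancel₀ _ (pow_ne_zero _ hn)

end IsDrawProcess

/-! ### Conditional limit law of one colour. -/

theorem rk_smul {a : ℝ} (ha : 0 < a) (x : Fin d → ℝ) : rk (a • x) = rk x := by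
  rw [rk_eq_iff]
  intro i j
  rw [rk_pos_lt_iff, Pi.smul_apply, Pi.smul_apply, smul_eq_mul, smul_eq_mul,
    mul_lt_mul_iff_right₀ ha]

/-- The strict order of distinct coordinates is an open condition, and dividing by `n` leaves the
ranking unchanged. -/
theorem eventually_rk_eq_of_mem_limitEvent {Ω : Type*} {X : ℕ → Ω → Fin d → ℝ} {x : Fin d → ℝ}
    (hx : ∀ i j, i ≠ j → x i ≠ x j) {ω : Ω} (hω : ω ∈ limitEvent X x) :
    ∀ᶠ n in atTop, rk (X n ω) = rk x := by
  have hlim : Tendsto (fun n : ℕ => (n : ℝ)⁻¹ • X n ω) atTop (𝓝 x) := hω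
  rw [tendsto_pi_nhds] at hlim
  have h1 : ∀ᶠ n : ℕ in atTop, ∀ i j, x j < x i →
      ((n : ℝ)⁻¹ • X n ω) j < ((n : ℝ)⁻¹ • X n ω) i := by
    rw [eventually_all]; intro i
    rw [eventually_all]; intro j
    by_cases hij : x j < x i
    · exact ((hlim j).eventually_lt (hlim i) hij).mono fun n hn _ => hn
    · exact Eventually.of_forall fun n h => (hij h).elim
  filter_upwards [h1, eventually_gt_atTop 0] with n hn hn0
  rw [← rk_smul (inv_pos.2 (Nat.cast_pos.2 hn0 : (0 : ℝ) < n)) (X n ω)]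
  exact rk_eq_of_lt (rk_pos_ne hx) fun i j hij => hn i j ((rk_pos_lt_iff x i j).1 hij)

/-- The two-point law of a centred and normalised Bernoulli variable. -/
noncomputable def normalizedBernoulli (p : ℝ) : Measure ℝ :=
  ENNReal.ofReal p • Measure.dirac ((1 - p) / √(p * (1 - p))) +
    ENNReal.ofReal (1 - p) • Measure.dirac (-p / √(p * (1 - p)))

theorem isProbabilityMeasure_normalizedBernoulli {p : ℝ} (h0 : 0 < p) (h1 : p < 1) :
    IsProbabilityMeasure (normalizedBernoulli p) := by
  constructor
  simp only [normalizedBernoulli, Measure.coe_add, Measure.coe_smul, Pi.add_apply, Pi.smul_apply,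
    measure_univ, smul_eq_mul, mul_one]
  rw [← ENNReal.ofReal_add h0.le (sub_pos.2 h1).le, add_sub_cancel, ENNReal.ofReal_one]

theorem integral_normalizedBernoulli {E : Type*} [NormedAddCommGroup E] [NormedSpace ℝ E]
    [CompleteSpace E] {p : ℝ} (h0 : 0 < p) (h1 : p < 1) (f : ℝ → E) :
    ∫ z, f z ∂(normalizedBernoulli p) =
      p • f ((1 - p) / √(p * (1 - p))) + (1 - p) • f (-p / √(p * (1 - p))) := by
  have hi : ∀ a, Integrable f (Measure.dirac a) := fun a => integrable_dirac (by simp)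
  rw [normalizedBernoulli, integral_add_measure ((hi _).smul_measure ENNReal.ofReal_ne_top)
    ((hi _).smul_measure ENNReal.ofReal_ne_top), integral_smul_measure, integral_smul_measure,
    integral_dirac, integral_dirac, ENNReal.toReal_ofReal h0.le,
    ENNReal.toReal_ofReal (sub_pos.2 h1).le]

namespace IsDrawProcess

variable {q : Ranking d → Fin d → ℝ} {Ω : Type*} {mΩ : MeasurableSpace Ω}
    {P : Measure Ω} {ℱ : Filtration ℕ mΩ} {X : ℕ → Ω → Fin d → ℝ}

theorem measurableSet_limitEvent (h : IsDrawProcess q P ℱ X) (x : Fin d → ℝ) :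
    MeasurableSet[⨆ n, ℱ n] (limitEvent X x) := by
  have hm : ∀ n : ℕ, Measurable[⨆ n, ℱ n] fun ω => (n : ℝ)⁻¹ • X n ω := by
    intro n
    have h1 := (h.adapted n).mono (le_iSup (fun n => (ℱ n : MeasurableSpace Ω)) n) le_rfl
    exact h1.const_smul ((n : ℝ)⁻¹)
  exact measurableSet_tendsto (l := atTop) (𝓝 x) hm

theorem sum_smul_exp_single (h : IsDrawProcess q P ℱ X) (r : Ranking d) (i : Fin d) (t : ℝ) :
    ∑ c, q r c •
        Complex.exp ((t * ((Pi.single c 1 : Fin d → ℝ) i - q r i) : ℝ) * Complex.I) =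
      q r i • Complex.exp ((t * (1 - q r i) : ℝ) * Complex.I) +
        (1 - q r i) • Complex.exp ((t * -q r i : ℝ) * Complex.I) := by
  rw [← Finset.add_sum_erase _ _ (Finset.mem_univ i), Pi.single_eq_same]
  congr 1
  have h1 : ∑ c ∈ Finset.univ.erase i, q r c = 1 - q r i := by
    have := Finset.add_sum_erase Finset.univ (q r) (Finset.mem_univ i)
    rw [h.sum_eq] at this
    linarith
  rw [← h1, Finset.sum_smul]
  refine Finset.sum_congr rfl fun c hc => ?_
  rw [Pi.single_eq_of_ne (Finset.ne_of_mem_erase hc).symm, zero_sub]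

/-- The conditional central limit theorem for one colour. -/
theorem tendsto_cond_real_le (h : IsDrawProcess q P ℱ X) {r : Ranking d} {i : Fin d}
    (h0 : 0 < q r i) (h1 : q r i < 1) {E : Set Ω}
    (hE : MeasurableSet[⨆ n, ℱ n] E) (hEr : ∀ ω ∈ E, ∀ᶠ n in atTop, rk (X n ω) = r)
    (hpos : 0 < P E) (y : ℝ) :
    Tendsto (fun n : ℕ => (P[|E]).real
      {ω | (X n ω i - n * q r i) / √(n * q r i * (1 - q r i)) ≤ y})
      atTop (𝓝 (cdf (gaussianReal 0 1) y)) := by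
  have := h.prob
  have hE' : MeasurableSet E := (iSup_le fun n => ℱ.le n) _ hE
  have hcond : IsProbabilityMeasure (P[|E]) := cond_isProbabilityMeasure hpos.ne'
  have hPE : P.real E ≠ 0 := (ENNReal.toReal_pos hpos.ne' (measure_ne_top _ _)).ne'
  set p := q r i with hp
  have hpq : 0 < p * (1 - p) := mul_pos h0 (sub_pos.2 h1)
  let S : ℕ → Ω → ℝ := fun n ω => (X n ω i - n * p) / √(n * p * (1 - p))
  have hSm : ∀ n, Measurable (S n) := fun n =>
    (((measurable_pi_apply i).comp (h.measurable n)).sub_const _).div_const _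
  have hprob : ∀ n, IsProbabilityMeasure ((P[|E]).map (S n)) := fun n =>
    Measure.isProbabilityMeasure_map (hSm n).aemeasurable
  let ρ : ℕ → ProbabilityMeasure ℝ := fun n => ⟨(P[|E]).map (S n), hprob n⟩
  let γ : ProbabilityMeasure ℝ := ⟨gaussianReal 0 1, inferInstance⟩
  have hchar : Tendsto ρ atTop (𝓝 γ) := by
    rw [ProbabilityMeasure.tendsto_iff_tendsto_charFun]
    intro s
    let t : ℕ → ℝ := fun n => s / √(n * p * (1 - p))
    have ht : Tendsto t atTop (𝓝 0) := by
      refine Tendsto.div_atTop tendsto_const_nhds (Real.tendsto_sqrt_atTop.comp ?_)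
      simp only [mul_assoc]
      exact tendsto_natCast_atTop_atTop.atTop_mul_const hpq
    have hB := isProbabilityMeasure_normalizedBernoulli h0 h1
    -- The i.i.d. theorem is used only for its analytic content, the limit of powers of the
    -- characteristic function of one normalised Bernoulli variable.
    have hclt := tendsto_charFun_inv_sqrt_mul_pow (P := normalizedBernoulli p) (X := id)
      aemeasurable_id (by
        rw [integral_normalizedBernoulli h0 h1]
        simp only [id, smul_eq_mul]
        ring) (by
        rw [integral_normalizedBernoulli h0 h1]
        simp only [Pi.pow_apply, id, smul_eq_mul, div_pow, Real.sq_sqrt hpq.le]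
        have h1' : 1 - p ≠ 0 := (sub_pos.2 h1).ne'
        field_simp
        ring) s
    rw [Measure.map_id] at hclt
    have hψ : ∀ n : ℕ, charFun (normalizedBernoulli p) ((√n)⁻¹ * s) = ∑ c, q r c •
        Complex.exp ((t n * ((Pi.single c 1 : Fin d → ℝ) i - p) : ℝ) * Complex.I) := by
      intro n
      rw [charFun_apply_real, integral_normalizedBernoulli h0 h1, hp, h.sum_smul_exp_single r i,
        ← hp]
      have hsq : √(n * p * (1 - p)) = √n * √(p * (1 - p)) := by
        rw [mul_assoc, Real.sqrt_mul (Nat.cast_nonneg n)]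
      simp only [t, hsq]
      congr 4 <;> push_cast <;> field_simp
    simp only [hψ] at hclt
    have hmain := h.tendsto_setIntegral_exp (i := i) ht (fun n => rfl) (Complex.exp_ne_zero _)
      hclt hE hEr
    have h2 := hmain.const_mul ((P.real E : ℂ)⁻¹)
    rw [← mul_assoc, inv_mul_cancel₀ (Complex.ofReal_ne_zero.2 hPE), one_mul] at h2
    have h3 : charFun (γ : Measure ℝ) s = Complex.exp (-s ^ 2 / 2) := by
      change charFun (gaussianReal 0 1) s = _
      rw [charFun_gaussianReal]
      congr 1
      simp
      ring
    rw [h3]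
    refine h2.congr fun n => ?_
    change _ = charFun ((P[|E]).map (S n)) s
    rw [charFun_apply_real, integral_map (hSm n).aemeasurable (by fun_prop), ProbabilityTheory.cond,
      integral_smul_measure, ENNReal.toReal_inv, ← measureReal_def, Complex.real_smul,
      Complex.ofReal_inv]
    congr 1
    refine integral_congr_ae (ae_of_all _ fun ω => ?_)
    simp only [S, t]
    congr 2
    rw [← Complex.ofReal_mul]
    congr 1
    ring
  have hport := ProbabilityMeasure.tendsto_measure_of_null_frontier_of_tendsto' hchar
    (E := Set.Iic y) (by
      rw [frontier_Iic]
      have := nullSingletonClass_gaussianReal (μ := 0) (v := 1) one_ne_zero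
      exact measure_singleton (μ := gaussianReal 0 1) y)
  have h4 := (ENNReal.tendsto_toReal (measure_ne_top _ _)).comp hport
  rw [cdf_eq_real]
  refine h4.congr fun n => ?_
  change ((P[|E]).map (S n) (Set.Iic y)).toReal = _
  rw [Measure.map_apply (hSm n) measurableSet_Iic]
  rfl

end IsDrawProcess

/-! ### Ranking-based Pólya urns -/

section Urn

variable {μ : Ranking d → Measure (Fin d → ℝ)}

theorem IsPolyaUrn.mean_rk_eq (hμ : IsPolyaUrn μ) {x : Fin d → ℝ}
    (hx : x ∈ distinctFixedPoints μ) : mean μ (rk x) = x := by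
  rw [← hμ.urnFunction_eq, hx.2.1]

theorem exists_gap {x : Fin d → ℝ} :
    ∃ ε > 0, ∀ i j, (rk x).pos i < (rk x).pos j → ε ≤ x i - x j := by
  obtain ⟨ε, hε, h⟩ := exists_pos_forall_le
    (f := fun p : {p : Fin d × Fin d // x p.2 < x p.1} => x p.1.1 - x p.1.2)
    fun p => sub_pos.2 p.2
  exact ⟨ε, hε, fun i j hij => h ⟨(i, j), (rk_pos_lt_iff x i j).1 hij⟩⟩

/-- The vector `e_i` has mass `mean μ r i > 0` and distinguishes `i` from `j`. This excludes the
degenerate alternative in quasi-domination. -/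
theorem IsPolyaUrn.measure_ne_pos (hμ : IsPolyaUrn μ) (r : Ranking d) {i j : Fin d} (hij : i ≠ j)
    (hpos : 0 < mean μ r i) : μ r {z | z i ≠ z j} ≠ 0 := by
  intro h0
  rw [hμ.mean_eq_single] at hpos
  refine hpos.ne' ?_
  rw [measureReal_def, measure_mono_null (t := {z | z i ≠ z j}) ?_ h0, ENNReal.toReal_zero]
  rintro z rfl
  simp [hij.symm]

theorem QuasiDominates.mean_lt (hμ : IsPolyaUrn μ) (hpos : ∀ r i, 0 < mean μ r i) {i j : Fin d}
    (hij : i ≠ j) (h : QuasiDominates μ i j) (r : Ranking d) (hr : r.pos i < r.pos j) :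
    mean μ r j < mean μ r i :=
  (h r hr).resolve_right (hμ.measure_ne_pos r hij (hpos r i))

theorem exists_initial_measure_limitEvent_pos (hμ : IsPolyaUrn μ) {x : Fin d → ℝ}
    (hx : x ∈ distinctFixedPoints μ) :
    ∃ x₀ : Fin d → ℝ, ∀ (Ω : Type*) (mΩ : MeasurableSpace Ω) (P : Measure Ω)
      (ℱ : Filtration ℕ mΩ) (X : ℕ → Ω → Fin d → ℝ),
      IsRankingBasedProcess μ (Measure.dirac x₀) P ℱ X → 0 < P (limitEvent X x) := by
  obtain ⟨ε, hε, hgap⟩ := exists_gap (x := x)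
  set L : ℝ := ((orderedPairs (rk x)).card + 1) / ε with hL
  have hL0 : 0 < L := by positivity
  -- The gaps of `x` are at least `ε`, so scaling by `L / ε` makes them at least the required `L`.
  refine ⟨(L / ε) • x, fun Ω mΩ P ℱ X hX => ?_⟩
  have h := hX.isDrawProcess hμ
  have := h.prob
  have hG : MeasurableSet[ℱ 0] (X 0 ⁻¹' {(L / ε) • x}) := h.adapted 0 (measurableSet_singleton _)
  have h1 : P.real (X 0 ⁻¹' {(L / ε) • x}) = 1 := by
    rw [measureReal_def, ← Measure.map_apply (h.measurable 0) (measurableSet_singleton _),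
      hX.initial]
    simp
  have h2 := h.measure_limitEvent_pos (rk_pos_ne hx.2.2) hε
    (by rw [hμ.mean_rk_eq hx]; exact hgap) hG (by rw [h1]; exact one_pos) ?_
  · rwa [hμ.mean_rk_eq hx] at h2
  · intro ω hω i j hij
    rw [show X 0 ω = _ from hω, Pi.smul_apply, Pi.smul_apply, smul_eq_mul, smul_eq_mul, ← mul_sub,
      ← hL]
    have := mul_le_mul_of_nonneg_left (hgap i j hij) (show 0 ≤ L / ε by positivity)
    rwa [div_mul_cancel₀ _ hε.ne'] at this

theorem measure_limitEvent_pos_of_mean_pos (hμ : IsPolyaUrn μ) (hpos : ∀ r i, 0 < mean μ r i)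
    {x : Fin d → ℝ} (hx : x ∈ distinctFixedPoints μ) {ν : Measure (Fin d → ℝ)} {Ω : Type*}
    {mΩ : MeasurableSpace Ω} {P : Measure Ω} {ℱ : Filtration ℕ mΩ} {X : ℕ → Ω → Fin d → ℝ}
    (hX : IsRankingBasedProcess μ ν P ℱ X) : 0 < P (limitEvent X x) := by
  obtain ⟨ε, hε, hgap⟩ := exists_gap (x := x)
  have h2 := (hX.isDrawProcess hμ).measure_limitEvent_pos_of_pos hpos (rk_pos_ne hx.2.2) hε
    (by rw [hμ.mean_rk_eq hx]; exact hgap)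
  rwa [hμ.mean_rk_eq hx] at h2

theorem ae_exists_mem_limitEvent (hμ : IsPolyaUrn μ) (hpos : ∀ r i, 0 < mean μ r i)
    (hre : Reinforcement μ) {ν : Measure (Fin d → ℝ)} {Ω : Type*}
    {mΩ : MeasurableSpace Ω} {P : Measure Ω} {ℱ : Filtration ℕ mΩ} {X : ℕ → Ω → Fin d → ℝ}
    (hX : IsRankingBasedProcess μ ν P ℱ X) :
    ∀ᵐ ω ∂P, ∃ x ∈ distinctFixedPoints μ, ω ∈ limitEvent X x := by
  have h := hX.isDrawProcess hμ
  have hdom : ∀ i j, i ≠ j → (∀ r : Ranking d, r.pos i < r.pos j → mean μ r j < mean μ r i) ∨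
      (∀ r : Ranking d, r.pos j < r.pos i → mean μ r i < mean μ r j) := by
    intro i j hij
    rcases hre i j with (hd | hd) | hd
    · exact Or.inl (hd.1.mean_lt hμ hpos hij)
    · exact Or.inr (hd.1.mean_lt hμ hpos hij.symm)
    · exact Or.inl (hd.1.mean_lt hμ hpos hij)
  filter_upwards [h.ae_exists_eventually_rk_eq hpos hdom, h.ae_lt_of_eventually_rk_eq hpos,
    h.ae_mem_limitEvent_of_eventually_rk_eq] with ω h1 h2 h3
  obtain ⟨r, hr, hev⟩ := h1
  have hlt := h2 r hev
  have hrk : rk (mean μ r) = r := rk_eq_of_lt hr hlt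
  refine ⟨mean μ r, ⟨⟨fun i => (hpos r i).le, hμ.sum_mean r⟩, ?_, fun i j hij => ?_⟩, h3 r hev⟩
  · rw [hμ.urnFunction_eq, hrk]
  · rcases lt_or_gt_of_ne (hr i j hij) with h' | h'
    · exact (hlt i j h').ne'
    · exact (hlt j i h').ne

end Urn

end RankingUrn

/-! ### The proposition. -/

theorem mainTheorem5 {d : ℕ} (μ : RankingUrn.Ranking d → Measure (Fin d → ℝ))
    (hμ : RankingUrn.IsPolyaUrn μ) :
    -- positive probability for some initial distribution
    (∀ x ∈ RankingUrn.distinctFixedPoints μ, ∃ ν : Measure (Fin d → ℝ),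
      (∃ (Ω : Type) (mΩ : MeasurableSpace Ω) (P : Measure Ω) (ℱ : Filtration ℕ mΩ)
        (X : ℕ → Ω → Fin d → ℝ), RankingUrn.IsRankingBasedProcess μ ν P ℱ X) ∧
      ∀ (Ω : Type*) (mΩ : MeasurableSpace Ω) (P : Measure Ω) (ℱ : Filtration ℕ mΩ)
        (X : ℕ → Ω → Fin d → ℝ), RankingUrn.IsRankingBasedProcess μ ν P ℱ X →
          0 < P (RankingUrn.limitEvent X x)) ∧
    -- positive probability for every initial distribution
    ((∀ r i, 0 < RankingUrn.mean μ r i) →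
      ∀ x ∈ RankingUrn.distinctFixedPoints μ, ∀ (ν : Measure (Fin d → ℝ))
        (Ω : Type*) (mΩ : MeasurableSpace Ω) (P : Measure Ω) (ℱ : Filtration ℕ mΩ)
        (X : ℕ → Ω → Fin d → ℝ), RankingUrn.IsRankingBasedProcess μ ν P ℱ X →
          0 < P (RankingUrn.limitEvent X x)) ∧
    -- almost sure convergence
    ((∀ r i, 0 < RankingUrn.mean μ r i) → RankingUrn.Reinforcement μ →
      ∀ (ν : Measure (Fin d → ℝ))
        (Ω : Type*) (mΩ : MeasurableSpace Ω) (P : Measure Ω) (ℱ : Filtration ℕ mΩ)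
        (X : ℕ → Ω → Fin d → ℝ), RankingUrn.IsRankingBasedProcess μ ν P ℱ X →
          ∀ᵐ ω ∂P, ∃ x ∈ RankingUrn.distinctFixedPoints μ, ω ∈ RankingUrn.limitEvent X x) ∧
    -- conditional central limit theorem
    (∀ (ν : Measure (Fin d → ℝ))
        (Ω : Type*) (mΩ : MeasurableSpace Ω) (P : Measure Ω) (ℱ : Filtration ℕ mΩ)
        (X : ℕ → Ω → Fin d → ℝ), RankingUrn.IsRankingBasedProcess μ ν P ℱ X →
      ∀ x ∈ RankingUrn.distinctFixedPoints μ, 0 < P (RankingUrn.limitEvent X x) →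
      ∀ i, 0 < x i → x i < 1 → ∀ y : ℝ,
        Tendsto (fun n : ℕ => (P[|RankingUrn.limitEvent X x]).real
            {ω | (X n ω i - n * x i) / √(n * x i * (1 - x i)) ≤ y})
          atTop (𝓝 (cdf (gaussianReal 0 1) y))) := by
  refine ⟨fun x hx => ?_, fun hpos x hx ν Ω mΩ P ℱ X hX => ?_, fun hpos hre ν Ω mΩ P ℱ X hX => ?_,
    fun ν Ω mΩ P ℱ X hX x hx hP i hi0 hi1 y => ?_⟩
  · obtain ⟨x₀, h⟩ := RankingUrn.exists_initial_measure_limitEvent_pos hμ hx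
    exact ⟨Measure.dirac x₀,
      RankingUrn.exists_isRankingBasedProcess hμ.toIsIncrementFamily x₀, h⟩
  · exact RankingUrn.measure_limitEvent_pos_of_mean_pos hμ hpos hx hX
  · exact RankingUrn.ae_exists_mem_limitEvent hμ hpos hre hX
  · have h := hX.isDrawProcess hμ
    have hm := hμ.mean_rk_eq hx
    have := h.tendsto_cond_real_le (r := RankingUrn.rk x) (i := i) (by rwa [hm]) (by rwa [hm])
      (h.measurableSet_limitEvent x)
      (fun ω hω => RankingUrn.eventually_rk_eq_of_mem_limitEvent hx.2.2 hω) hP y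
    rwa [hm] at this
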